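/- Let $d=2$. For linear maps $\Lambda,\Gamma$ on $2\times2$ complex matrices put $F(\Lambda,\Gamma)=\int\operatorname{tr}\big(\Lambda(\psi)^\dagger\Gamma(\psi)\big)\,d\psi$, the integral being uniform over all pure states $\psi$. Let $\mathbb G=\{\mathcal G\}$ be a finite family of single-qubit unitary channels forming a unitary 2-design, and let $\tilde{\mathbb G}=\{\tilde{\mathcal G}\}$ be a noisy implementation: to each $\mathcal G$ is assigned an arbitrary (gate-dependent) completely positive trace-preserving map $\tilde{\mathcal G}$. Write $\mathcal G_{m:1}=\mathcal G_m\cdots\mathcal G_1$ and $\tilde{\mathcal G}_{m:1}=\tilde{\mathcal G}_m\cdots\tilde{\mathcal G}_1$, let $\mathbb E$ be the average over independent, uniformly chosen gates, and put $$\mathcal F(\tilde{\mathbb G},\mathbb G,m)=\mathbb E\,F(\tilde{\mathcal G}_{m:1},\mathcal G_{m:1}),\qquad \mathcal E_R^{(4)}=\mathbb E\big[\mathcal G_{4:1}^\dagger\tilde{\mathcal G}_{4:1}\big].$$ Let $\Pi_{\rm tr}(\rho)=\rho-\tfrac12\operatorname{tr}(\rho)\,\mathbb I$. In the Liouville (Pauli-basis)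 representation let $\boldsymbol{\mathcal T}=\mathbb E[\boldsymbol{\mathcal G}\boldsymbol\Pi_{\rm tr}\otimes\tilde{\boldsymbol{\mathcal G}}]$. Write $B(\Lambda)$ for the $3\times3$ block of the Liouville matrix of $\Lambda$ acting on Bloch vectors. There are absolute constants $C,\varepsilon>0$ such that, whenever $\mathcal F(\tilde{\mathbb G},\mathbb G,1)\ge1-\varepsilon$, the following hold. 1. The maximum of $F(\mathcal E_R^{(4)}\mathcal V,\mathcal I)$ over all unitary channels $\mathcal V$ is attained at exactly one unitary channel $$\mathcal U=\operatorname*{arg\,max}_{\mathcal V}F\big(\mathcal E_R^{(4)}\mathcal V,\mathcal I\big).$$ 2. $\boldsymbol{\mathcal T}$ has a highest eigenvalue $p$ (a real eigenvalue such that every complex eigenvalue $\lambda$ satisfies $|\lambda|\le p$), and for this $\mathcal U$ and every $m\ge0$ $$\Big|\mathcal F(\tilde{\mathbb G},\mathcal U\mathbb G\mathcal U^\dagger,m)-\Big(\tfrac12+\tfrac12\,p^m\Big)\Big|\le C(1-p)^2 .$$ 3. $\mathcal U$ cancels the unitary part of the 4th-order right error: for $\mathcal D=\mathcal E_R^{(4)}\mathcal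 U$ the block $B(\mathcal D)$ is symmetric positive definite, $B(\mathcal E_R^{(4)})=B(\mathcal D)\,B(\mathcal U)^{T}$, and $\mathcal D$ is incoherent, that is, $$\Big|\frac{\langle\boldsymbol\Pi_{\rm tr},\boldsymbol{\mathcal D}\rangle}{\|\boldsymbol\Pi_{\rm tr}\|_F^2}-\frac{\|\boldsymbol{\mathcal D}\boldsymbol\Pi_{\rm tr}\|_F}{\|\boldsymbol\Pi_{\rm tr}\|_F}\Big|\le C\,\big(1-F(\mathcal D,\mathcal I)\big)^2 .$$ 4. $\mathcal U$ is obtained from the polar decomposition of the Bloch block: whenever $B(\mathcal E_R^{(4)})=DV$ with $D$ symmetric positive semidefinite and $V$ orthogonal, $V^{T}$ is the Bloch block of a unitary channel, and that channel is the maximizer $\mathcal U$. -/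

import Mathlib

open MeasureTheory Matrix
open scoped BigOperators Kronecker ComplexOrder

noncomputable section

/-! ### Superoperators and channels -/

/-- Linear maps on `d × d` complex matrices; the product is composition. -/
abbrev Superop (d : ℕ) : Type := Module.End ℂ (Matrix (Fin d) (Fin d) ℂ)

/-- The unitary channel `ρ ↦ u ρ u†` ("physical unitary"). -/
def unitaryChannel {d : ℕ} (u : unitaryGroup (Fin d) ℂ) : Superop d where
  toFun ρ := (u : Matrix (Fin d) (Fin d) ℂ) * ρ * (u : Matrix (Fin d) (Fin d) ℂ)ᴴ
  map_add' x y := by rw [mul_add, add_mul]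
  map_smul' c x := by simp

/-- The ampliation `id_k ⊗ Λ`: the map `Λ` is applied to each of the `k × k` blocks of size
`d × d` of the matrix `M`. -/
def ampliation {d : ℕ} (Λ : Superop d) (k : ℕ)
    (M : Matrix (Fin k × Fin d) (Fin k × Fin d) ℂ) :
    Matrix (Fin k × Fin d) (Fin k × Fin d) ℂ :=
  Matrix.of fun x y => Λ (Matrix.of fun a b => M (x.1, a) (y.1, b)) x.2 y.2

/-- Quantum channels: completely positive and trace preserving (that is, leakage-free) maps. -/
structure IsChannel {d : ℕ} (Λ : Superop d) : Prop where
  completelyPositive : ∀ (k : ℕ) (M : Matrix (Fin k × Fin d) (Fin k × Fin d) ℂ),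
    M.PosSemidef → (ampliation Λ k M).PosSemidef
  tracePreserving : ∀ ρ : Matrix (Fin d) (Fin d) ℂ, (Λ ρ).trace = ρ.trace

/-! ### Average fidelity -/

/-- The rank one projector `|ψ⟩⟨ψ|` on a vector `ψ`. -/
def pureState {d : ℕ} (ψ : EuclideanSpace ℂ (Fin d)) : Matrix (Fin d) (Fin d) ℂ :=
  vecMulVec (fun i => ψ i) (fun i => star (ψ i))

/-- The average fidelity `F(Λ, Γ) = ∫ ⟨Λ(ψ), Γ(ψ)⟩ dψ`, where `⟨A, B⟩ = tr (A† B)` and `ψ` is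
uniform over all pure states, i.e. distributed as the normalized surface measure of the unit
sphere of `ℂ^d`. (The integrand is real when `Λ` and `Γ` preserve hermiticity.) -/
def avgFidelity {d : ℕ} (Λ Γ : Superop d) : ℝ :=
  ⨍ ψ : Metric.sphere (0 : EuclideanSpace ℂ (Fin d)) 1,
    (((Λ (pureState ψ.1))ᴴ * Γ (pureState ψ.1)).trace).re
      ∂((volume : Measure (EuclideanSpace ℂ (Fin d))).toSphere)

/-! ### Circuits -/

/-- The circuit `g_{m:1} = g (s m) ⋯ g (s 2) g (s 1)` built from a gate-set `g` indexed by `ι`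
along the sequence `s` of `m` labels. -/
def circuit {ι M : Type*} [Monoid M] (g : ι → M) : (m : ℕ) → (Fin m → ι) → M
  | 0, _ => 1
  | m + 1, s => g (s (Fin.last m)) * circuit g m (Fin.init s)

/-- The gate-set circuit fidelity `𝓕(𝔾', 𝔾, m)`: the expectation, over `m` independent uniformly
random labels, of the average fidelity of the circuit over `𝔾'` to the circuit over `𝔾`. -/
def gateSetFidelity {d : ℕ} {ι : Type*} [Fintype ι] (N G : ι → Superop d) (m : ℕ) : ℝ :=
  𝔼 s : Fin m → ι, avgFidelity (circuit N m s) (circuit G m s)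

/-- The `m`-th order right error `E[(𝒢_{m:1})† 𝒢'_{m:1}]` of a noisy implementation `N` of the
gates `U`. The Hilbert–Schmidt adjoint of the unitary channel of `u` is the channel of `u†`. -/
def rightError {d : ℕ} {ι : Type*} [Fintype ι] (U : ι → unitaryGroup (Fin d) ℂ)
    (N : ι → Superop d) (m : ℕ) : Superop d :=
  𝔼 s : Fin m → ι, unitaryChannel (star (circuit U m s)) * circuit N m s

/-- `W` attains `max_V F(Λ ∘ 𝒱, ℐ)` over all unitary channels `𝒱`. -/
def IsOptimalCorrection {d : ℕ} (Λ : Superop d) (W : unitaryGroup (Fin d) ℂ) : Prop :=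
  ∀ V : unitaryGroup (Fin d) ℂ,
    avgFidelity (Λ * unitaryChannel V) 1 ≤ avgFidelity (Λ * unitaryChannel W) 1

/-- A finite family of unitaries is a unitary 2-design: averaging `(U ⊗ U) A (U ⊗ U)†` over the
family gives, for every `A`, the same as averaging it over the Haar probability measure of the
unitary group. (The Haar probability measure is the unique left invariant Borel probability
measure.) -/
def IsUnitaryTwoDesign {d : ℕ} {ι : Type*} [Fintype ι]
    (U : ι → unitaryGroup (Fin d) ℂ) : Prop :=
  ∃ μ : @Measure (unitaryGroup (Fin d) ℂ) (borel _),
    @IsProbabilityMeasure _ (borel _) μ ∧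
    (∀ g : unitaryGroup (Fin d) ℂ,
      @Measure.map _ _ (borel _) (borel _) (fun v => g * v) μ = μ) ∧
    ∀ (A : Matrix (Fin d × Fin d) (Fin d × Fin d) ℂ) (x y : Fin d × Fin d),
      (𝔼 i, (((U i).1 ⊗ₖ (U i).1) * A * ((U i).1 ⊗ₖ (U i).1)ᴴ) x y) =
        @integral _ _ _ _ (borel _) μ
          (fun v : unitaryGroup (Fin d) ℂ => ((v.1 ⊗ₖ v.1) * A * (v.1 ⊗ₖ v.1)ᴴ) x y)

/-! ### The Liouville representation of a qubit -/

/-- The identity and the Pauli matrices `σ_x, σ_y, σ_z`. -/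
def pauli : Fin 4 → Matrix (Fin 2) (Fin 2) ℂ :=
  ![!![1, 0; 0, 1], !![0, 1; 1, 0], !![0, -Complex.I; Complex.I, 0], !![1, 0; 0, -1]]

/-- The Liouville (process) matrix of a hermiticity preserving qubit map, in the orthonormal basis
`σ_j / √2`. -/
def liouville (Λ : Superop 2) : Matrix (Fin 4) (Fin 4) ℝ :=
  Matrix.of fun j k => ((pauli j * Λ (pauli k)).trace).re / 2

/-- The `3 × 3` block of the Liouville matrix that acts on Bloch vectors. -/
def blochBlock (Λ : Superop 2) : Matrix (Fin 3) (Fin 3) ℝ :=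
  (liouville Λ).submatrix Fin.succ Fin.succ

/-- The projector `ρ ↦ ρ - (tr ρ / d) 1` onto the traceless matrices, for `d = 2`. -/
def tracelessProj : Superop 2 where
  toFun ρ := ρ - (ρ.trace / 2) • (1 : Matrix (Fin 2) (Fin 2) ℂ)
  map_add' x y := by rw [trace_add, add_div, add_smul]; abel
  map_smul' c x := by
    simp only [trace_smul, smul_eq_mul, RingHom.id_apply, smul_sub, smul_smul, mul_div_assoc]

/-- The Hilbert–Schmidt inner product of real matrices. -/
def hsInner {n : Type*} [Fintype n] (A B : Matrix n n ℝ) : ℝ := (Aᵀ * B).trace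

/-- The Frobenius norm of a real matrix. -/
def frobNorm {n : Type*} [Fintype n] (A : Matrix n n ℝ) : ℝ := √(hsInner A A)

/-- The amount by which a map `Λ` fails the equality
`⟨Π, Λ⟩ / ‖Π‖_F² = ‖Λ Π‖_F / ‖Π‖_F`, where `Π` is the projector onto traceless matrices. A channel
is incoherent when this is of the order of the square of its infidelity. -/
def coherenceDefect (Λ : Superop 2) : ℝ :=
  |hsInner (liouville tracelessProj) (liouville Λ) / frobNorm (liouville tracelessProj) ^ 2 -
    frobNorm (liouville Λ * liouville tracelessProj) / frobNorm (liouville tracelessProj)|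

/-- The twirling superchannel `𝒯 = E[𝒢_tr ⊗ 𝒢']` with `𝒢_tr = 𝒢 Π_tr`, where `𝒢` are the ideal
gates and `𝒢'` the noisy ones. -/
def twirl {ι : Type*} [Fintype ι] (U : ι → unitaryGroup (Fin 2) ℂ) (N : ι → Superop 2) :
    Matrix (Fin 4 × Fin 4) (Fin 4 × Fin 4) ℝ :=
  𝔼 i, liouville (unitaryChannel (U i) * tracelessProj) ⊗ₖ liouville (N i)

/-- The real number `p` is the highest eigenvalue of the real matrix `A`: it is an eigenvalue, and
no complex eigenvalue of `A` exceeds it in modulus. -/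
def IsHighestEigenvalue {n : Type*} [Fintype n] [DecidableEq n] (A : Matrix n n ℝ) (p : ℝ) :
    Prop :=
  (p : ℂ) ∈ spectrum ℂ (A.map (fun x : ℝ => (x : ℂ))) ∧
    ∀ μ ∈ spectrum ℂ (A.map (fun x : ℝ => (x : ℂ))), ‖μ‖ ≤ p

end

/-!
In the Bloch picture a circuit of length `m` has average fidelity `1/2 + tr (L ^ m 1) / 6`, where
`L X = E[Rᵀ X B]` for the Bloch blocks `R` of the ideal and `B` of the noisy gates. Because `R` is
a 2-design, `L` is within `η` of the orthogonal projection onto the identity, where `η²` is of the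
order of the infidelity. Because the `B` are contractions, the symmetric part of `1 - L 1` is even
of size `η²`. So `L` has a simple dominant eigenvalue `p` with `1 - p` of order `η²`, the
corresponding right and left eigenvectors differ from the identity by `η` in the antisymmetric and
by `η²` in the symmetric directions, and the fidelity follows `p ^ m` up to the product of these
deviations.

Antisymmetric deviations are generators of rotations, hence can be absorbed into the ideal gates.
Conjugating these by `O` replaces `L ^ m X` by `O L ^ m (Oᵀ X)`. The rotation that maximizes the
fidelity makes `L ^ 4 1 O` symmetric by the polar decomposition. Since `L ^ 4` projects onto the
dominant eigenvector up to `η ^ 4`, the right eigenvector of the conjugated twirl is then symmetric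
up to `η ^ 4`, so that the product of the deviations is of order `η ^ 4`. At `m = 1` the resulting
estimate gives `η² ≲ 1 - p`.
-/

noncomputable section

/-! ### Perturbation of a rank one projection -/

section Perturbation

open InnerProductSpace

variable {H : Type*} [NormedAddCommGroup H] [InnerProductSpace ℝ H]

theorem norm_sq_add_norm_sq_rotation (r s : ℝ) (u v : H) :
    ‖r • u - s • v‖ ^ 2 + ‖s • u + r • v‖ ^ 2 = (r ^ 2 + s ^ 2) * (‖u‖ ^ 2 + ‖v‖ ^ 2) := by
  rw [norm_sub_sq_real, norm_add_sq_real]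
  simp only [norm_smul, mul_pow, Real.norm_eq_abs, sq_abs, real_inner_smul_left,
    real_inner_smul_right]
  ring

theorem abs_inner_le_starProjection (K : Submodule ℝ H) [K.HasOrthogonalProjection] (a b : H) :
    |inner ℝ a b| ≤ ‖K.starProjection a‖ * ‖K.starProjection b‖
      + ‖Kᗮ.starProjection a‖ * ‖Kᗮ.starProjection b‖ := by
  have key : inner ℝ a b = inner ℝ (K.starProjection a) (K.starProjection b)
      + inner ℝ (Kᗮ.starProjection a) (Kᗮ.starProjection b) := by
    rw [Submodule.inner_starProjection_left_eq_right, Submodule.inner_starProjection_left_eq_right,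
      K.starProjection_eq_self_iff.2 (K.starProjection_apply_mem b),
      Kᗮ.starProjection_eq_self_iff.2 (Kᗮ.starProjection_apply_mem b), ← inner_add_right,
      K.starProjection_add_starProjection_orthogonal]
  rw [key]
  exact (abs_add_le _ _).trans
    (add_le_add (abs_real_inner_le_norm _ _) (abs_real_inner_le_norm _ _))

variable [CompleteSpace H]

section Resolvent

variable {E : H →L[ℝ] H} {p : ℝ}

theorem mem_resolventSet_of_opNorm_lt (h : ‖E‖ < p) : p ∈ resolventSet ℝ E := by
  have hp : ‖p⁻¹ • E‖ < 1 := by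
    have hp0 : 0 < p := (norm_nonneg E).trans_lt h
    rwa [norm_smul, norm_inv, Real.norm_of_nonneg hp0.le, inv_mul_lt_one₀ hp0]
  have hp0 : p ≠ 0 := ((norm_nonneg E).trans_lt h).ne'
  have key : algebraMap ℝ (H →L[ℝ] H) p - E = p • (1 - p⁻¹ • E) := by
    rw [smul_sub, smul_smul, mul_inv_cancel₀ hp0, one_smul, Algebra.algebraMap_eq_smul_one]
  rw [spectrum.mem_resolventSet_iff, key]
  exact (isUnit_one_sub_of_norm_lt_one hp).smul (Units.mk0 p hp0)

theorem smul_resolvent_apply (h : ‖E‖ < p) (u : H) :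
    p • resolvent E p u = u + E (resolvent E p u) := by
  have key := Ring.mul_inverse_cancel _
    (spectrum.mem_resolventSet_iff.1 (mem_resolventSet_of_opNorm_lt h))
  have := congrArg (fun T : H →L[ℝ] H => T u) key
  simp only [Algebra.algebraMap_eq_smul_one, mul_apply_eq_comp, _root_.sub_apply, _root_.smul_apply,
    one_apply_eq_self, sub_eq_iff_eq_add] at this
  rwa [resolvent, Algebra.algebraMap_eq_smul_one]

theorem norm_resolvent_apply_le (h : ‖E‖ < p) (u : H) :
    ‖resolvent E p u‖ ≤ ‖u‖ / (p - ‖E‖) := by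
  have hp0 : 0 ≤ p := (norm_nonneg E).trans h.le
  have key := norm_add_le u (E (resolvent E p u))
  rw [← smul_resolvent_apply h, norm_smul, Real.norm_of_nonneg hp0] at key
  rw [le_div_iff₀ (sub_pos.2 h)]
  linarith [E.le_opNorm (resolvent E p u)]

theorem continuousOn_resolvent_apply (u : H) :
    ContinuousOn (fun p => resolvent E p u) (Set.Ioi ‖E‖) := fun _ hp =>
  ((spectrum.hasDerivAt_resolvent_const_left
    (mem_resolventSet_of_opNorm_lt hp)).continuousAt.clm_apply
      continuousAt_const).continuousWithinAt

end Resolvent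

variable {e : H} {E L : H →L[ℝ] H} {η : ℝ}

theorem exists_inner_resolvent_eq_one (he : ‖e‖ = 1) (hη : η ≤ 1 / 20) (hE : ‖E‖ ≤ η) :
    ∃ p : ℝ, |p - 1| ≤ 2 * η ∧ inner ℝ e (resolvent E p e) = 1 := by
  have hη0 : 0 ≤ η := (norm_nonneg E).trans hE
  have hlt : ∀ p ∈ Set.Icc (1 - 2 * η) (1 + 2 * η), ‖E‖ < p := fun p hp => by linarith [hp.1]
  have hinner : ∀ p ∈ Set.Icc (1 - 2 * η) (1 + 2 * η),
      |p * inner ℝ e (resolvent E p e) - 1| ≤ η * (1 / (p - η)) := fun p hp => by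
    have hnorm : ‖resolvent E p e‖ ≤ 1 / (p - η) :=
      (norm_resolvent_apply_le (hlt p hp) e).trans <| by
        rw [he]; gcongr; linarith [hp.1]
    have hsplit : p * inner ℝ e (resolvent E p e) - 1 = inner ℝ e (E (resolvent E p e)) := by
      rw [← real_inner_smul_right, smul_resolvent_apply (hlt p hp), inner_add_right,
        real_inner_self_eq_norm_sq, he]
      ring
    rw [hsplit]
    refine (abs_real_inner_le_norm _ _).trans ?_
    rw [he, one_mul]
    exact (E.le_opNorm _).trans (by gcongr)
  have hcont : ContinuousOn (fun p => inner ℝ e (resolvent E p e))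
      (Set.Icc (1 - 2 * η) (1 + 2 * η)) :=
    continuousOn_const.inner ((continuousOn_resolvent_apply e).mono hlt)
  have hright : inner ℝ e (resolvent E (1 + 2 * η) e) ≤ 1 := by
    have hmem : 1 + 2 * η ∈ Set.Icc (1 - 2 * η) (1 + 2 * η) := ⟨by linarith, le_rfl⟩
    have hup : η * (1 / (1 + 2 * η - η)) ≤ η :=
      mul_le_of_le_one_right hη0 ((div_le_one (by linarith)).2 (by linarith))
    nlinarith [(abs_le.1 (hinner _ hmem)).2]
  have hleft : 1 ≤ inner ℝ e (resolvent E (1 - 2 * η) e) := by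
    have hmem : 1 - 2 * η ∈ Set.Icc (1 - 2 * η) (1 + 2 * η) := ⟨le_rfl, by linarith⟩
    have hup : η * (1 / (1 - 2 * η - η)) ≤ η * 2 := by
      gcongr
      rw [div_le_iff₀ (by linarith)]
      linarith
    nlinarith [(abs_le.1 (hinner _ hmem)).1]
  obtain ⟨p, hp, hpe⟩ := intermediate_value_Icc' (by linarith) hcont ⟨hright, hleft⟩
  exact ⟨p, abs_le.2 ⟨by linarith [hp.1], by linarith [hp.2]⟩, hpe⟩

/- The eigenvectors of `L = e ⊗ e + E` with `⟪e, x⟫ = 1` are the vectors `x = (p - E)⁻¹ e`, where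
`p` solves the scalar equation `⟪e, (p - E)⁻¹ e⟫ = 1`. -/
theorem exists_eigenvector_near (he : ‖e‖ = 1) (hη : η ≤ 1 / 20)
    (hL : ‖L - rankOne ℝ e e‖ ≤ η) :
    ∃ (p : ℝ) (x : H), L x = p • x ∧ inner ℝ e x = 1 ∧ |p - 1| ≤ 2 * η ∧ ‖x - e‖ ≤ 6 * η := by
  obtain ⟨p, hp, hpe⟩ := exists_inner_resolvent_eq_one he hη hL
  have hlt : ‖L - rankOne ℝ e e‖ < p := by linarith [(abs_le.1 hp).1]
  set x := resolvent (L - rankOne ℝ e e) p e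
  have hx : p • x = e + (L - rankOne ℝ e e) x := smul_resolvent_apply hlt e
  refine ⟨p, x, ?_, hpe, hp, ?_⟩
  · rw [hx, _root_.sub_apply, rankOne_apply, hpe, one_smul, add_sub_cancel]
  have hsub : x - e = (1 - p) • x + (L - rankOne ℝ e e) x := by
    rw [sub_smul, one_smul, hx]; abel
  have hx2 : ‖x‖ ≤ 2 := (norm_resolvent_apply_le hlt e).trans <| by
    rw [he, div_le_iff₀ (by linarith)]
    linarith [(abs_le.1 hp).1]
  have hη0 : 0 ≤ η := (norm_nonneg _).trans hL
  calc ‖x - e‖ ≤ ‖(1 - p) • x‖ + ‖(L - rankOne ℝ e e) x‖ := hsub ▸ norm_add_le _ _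
    _ ≤ |1 - p| * ‖x‖ + ‖L - rankOne ℝ e e‖ * ‖x‖ := by
      rw [norm_smul, Real.norm_eq_abs]
      exact add_le_add_right (ContinuousLinearMap.le_opNorm _ _) _
    _ ≤ 2 * η * 2 + η * 2 := by rw [abs_sub_comm]; gcongr
    _ = 6 * η := by ring

variable {K : Submodule ℝ H} [K.HasOrthogonalProjection] {x y : H} {p : ℝ}

/-- The operator `L` is within `η` of the orthogonal projection onto the unit vector `e ∈ K`, and
the `K`-components of `e - L e` and of `e - L† e` are of second order. For a twirl, `K` is the space
of symmetric matrices. -/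
structure IsNearProjection (K : Submodule ℝ H) [K.HasOrthogonalProjection] (e : H)
    (L : H →L[ℝ] H) (η : ℝ) : Prop where
  norm_eq_one : ‖e‖ = 1
  mem : e ∈ K
  norm_sub_le : ‖L - rankOne ℝ e e‖ ≤ η
  norm_proj_le : ‖K.starProjection (e - L e)‖ ≤ η ^ 2
  norm_proj_adjoint_le : ‖K.starProjection (e - L.adjoint e)‖ ≤ η ^ 2

/-- A right and a left eigenvector of `L`, for the same eigenvalue `p`, as close to `e` as the
spectral perturbation theory of a near projection makes them. -/
structure IsDominantPair (K : Submodule ℝ H) [K.HasOrthogonalProjection] (e : H)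
    (L : H →L[ℝ] H) (η p : ℝ) (x y : H) : Prop where
  right : L x = p • x
  left : L.adjoint y = p • y
  inner_right : inner ℝ e x = 1
  inner_left : inner ℝ e y = 1
  abs_sub_one_le : |p - 1| ≤ 7 * η ^ 2
  norm_right_sub_le : ‖x - e‖ ≤ 6 * η
  norm_left_sub_le : ‖y - e‖ ≤ 6 * η
  norm_proj_right_sub_le : ‖K.starProjection (x - e)‖ ≤ 16 * η ^ 2
  norm_proj_left_sub_le : ‖K.starProjection (y - e)‖ ≤ 16 * η ^ 2

namespace IsNearProjection

theorem nonneg (h : IsNearProjection K e L η) : 0 ≤ η := (norm_nonneg _).trans h.norm_sub_le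

theorem adjoint (h : IsNearProjection K e L η) : IsNearProjection K e L.adjoint η where
  norm_eq_one := h.norm_eq_one
  mem := h.mem
  norm_sub_le := by
    rw [← LinearIsometryEquiv.norm_map ContinuousLinearMap.adjoint, map_sub,
      ContinuousLinearMap.adjoint_adjoint, adjoint_rankOne]
    exact h.norm_sub_le
  norm_proj_le := h.norm_proj_adjoint_le
  norm_proj_adjoint_le := by
    rw [ContinuousLinearMap.adjoint_adjoint]
    exact h.norm_proj_le

theorem norm_apply_sub_le (h : IsNearProjection K e L η) (z : H) :
    ‖L z - inner ℝ e z • e‖ ≤ η * ‖z‖ :=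
  ContinuousLinearMap.le_of_opNorm_le _ h.norm_sub_le z

theorem norm_sub_apply_le (h : IsNearProjection K e L η) : ‖e - L e‖ ≤ η := by
  have := h.norm_apply_sub_le e
  rwa [real_inner_self_eq_norm_sq, h.norm_eq_one, one_pow, one_smul, mul_one,
    norm_sub_rev] at this

theorem inner_apply_sub (h : IsNearProjection K e L η) (hx : L x = p • x)
    (hex : inner ℝ e x = 1) :
    inner ℝ e (L e) - p = inner ℝ (e - L.adjoint e) (x - e) := by
  have hp : p = inner ℝ (L.adjoint e) x := by
    rw [ContinuousLinearMap.adjoint_inner_left, hx, real_inner_smul_right, hex, mul_one]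
  rw [← ContinuousLinearMap.adjoint_inner_left, hp, inner_sub_left, inner_sub_right,
    inner_sub_right, hex, real_inner_self_eq_norm_sq, h.norm_eq_one]
  ring

theorem abs_inner_apply_sub_one_le (h : IsNearProjection K e L η) :
    |inner ℝ e (L e) - 1| ≤ η ^ 2 := by
  have key : inner ℝ e (L e) - 1 = -inner ℝ e (K.starProjection (e - L e)) := by
    rw [← Submodule.inner_starProjection_left_eq_right,
      Submodule.starProjection_eq_self_iff.2 h.mem, inner_sub_right,
      real_inner_self_eq_norm_sq, h.norm_eq_one]
    ring
  rw [key, abs_neg]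
  refine (abs_real_inner_le_norm _ _).trans ?_
  rw [h.norm_eq_one, one_mul]
  exact h.norm_proj_le

/-- The first order term of the eigenvalue vanishes, because `e - L e` is of second order on `K`. -/
theorem abs_eigenvalue_sub_one_le (h : IsNearProjection K e L η) (hx : L x = p • x)
    (hex : inner ℝ e x = 1) (hxe : ‖x - e‖ ≤ 6 * η) : |p - 1| ≤ 7 * η ^ 2 := by
  have h1 : |inner ℝ e (L e) - p| ≤ η * (6 * η) := by
    rw [h.inner_apply_sub hx hex]
    exact (abs_real_inner_le_norm _ _).trans
      (mul_le_mul h.adjoint.norm_sub_apply_le hxe (norm_nonneg _) h.nonneg)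
  have h2 := h.abs_inner_apply_sub_one_le
  rw [abs_le] at h1 h2 ⊢
  constructor <;> nlinarith

theorem norm_proj_eigenvector_sub_le (h : IsNearProjection K e L η) (hη : η ≤ 1 / 50)
    (hx : L x = p • x) (hex : inner ℝ e x = 1) (hxe : ‖x - e‖ ≤ 6 * η) :
    ‖K.starProjection (x - e)‖ ≤ 16 * η ^ 2 := by
  have hp := h.abs_eigenvalue_sub_one_le hx hex hxe
  have hx1 : ‖x‖ ≤ 9 / 8 := by
    have := norm_le_norm_add_norm_sub' x e
    rw [h.norm_eq_one] at this
    linarith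
  have hdev : ‖L (x - e) - inner ℝ e (x - e) • e‖ ≤ η * (6 * η) :=
    (h.norm_apply_sub_le _).trans (by gcongr; exact h.nonneg)
  have hsplit : x - e = (1 - p) • x - (e - L e) + (L (x - e) - inner ℝ e (x - e) • e) := by
    rw [inner_sub_right, hex, real_inner_self_eq_norm_sq, h.norm_eq_one, map_sub, hx, sub_smul]
    simp only [one_smul, one_pow, sub_self, zero_smul, sub_zero]
    abel
  have hproj : ∀ z, ‖K.starProjection z‖ ≤ ‖z‖ := K.norm_starProjection_apply_le
  calc ‖K.starProjection (x - e)‖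
      = ‖K.starProjection ((1 - p) • x) - K.starProjection (e - L e)
          + K.starProjection (L (x - e) - inner ℝ e (x - e) • e)‖ := by
        rw [← map_sub, ← map_add, ← hsplit]
    _ ≤ ‖K.starProjection ((1 - p) • x)‖ + ‖K.starProjection (e - L e)‖
          + ‖K.starProjection (L (x - e) - inner ℝ e (x - e) • e)‖ :=
        (norm_add_le _ _).trans (add_le_add_left (_root_.norm_sub_le _ _) _)
    _ ≤ 7 * η ^ 2 * (9 / 8) + η ^ 2 + η * (6 * η) := by
        gcongr
        · refine (hproj _).trans ?_
          rw [norm_smul, Real.norm_eq_abs, abs_sub_comm]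
          gcongr
        · exact h.norm_proj_le
        · exact (hproj _).trans hdev
    _ ≤ 16 * η ^ 2 := by nlinarith [sq_nonneg η]

/-- The right and left eigenvalues agree because the eigenvectors are not orthogonal. -/
theorem exists_isDominantPair (h : IsNearProjection K e L η) (hη : η ≤ 1 / 50) :
    ∃ p x y, IsDominantPair K e L η p x y := by
  obtain ⟨p, x, hx, hex, -, hxe⟩ :=
    exists_eigenvector_near h.norm_eq_one (hη.trans (by norm_num)) h.norm_sub_le
  obtain ⟨q, y, hy, hey, -, hye⟩ :=
    exists_eigenvector_near h.norm_eq_one (hη.trans (by norm_num)) h.adjoint.norm_sub_le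
  have hxy : inner ℝ y x ≠ 0 := fun h0 => by
    have key : inner ℝ (y - e) (x - e) = -1 := by
      rw [inner_sub_left, inner_sub_right, inner_sub_right, h0, hex, real_inner_comm, hey,
        real_inner_self_eq_norm_sq, h.norm_eq_one]
      norm_num
    have := (abs_real_inner_le_norm (y - e) (x - e)).trans
      (mul_le_mul hye hxe (norm_nonneg _) (by linarith [h.nonneg]))
    rw [key, abs_neg, abs_one] at this
    nlinarith [h.nonneg]
  obtain rfl : p = q := by
    have := ContinuousLinearMap.adjoint_inner_left L x y
    rw [hy, hx, real_inner_smul_left, real_inner_smul_right] at this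
    exact (mul_right_cancel₀ hxy this).symm
  exact ⟨p, x, y, hx, hy, hex, hey, h.abs_eigenvalue_sub_one_le hx hex hxe, hxe, hye,
    h.norm_proj_eigenvector_sub_le hη hx hex hxe,
    h.adjoint.norm_proj_eigenvector_sub_le hη hy hey hye⟩

end IsNearProjection

namespace IsDominantPair

theorem inner_left_right_sub_one (he : ‖e‖ = 1) (h : IsDominantPair K e L η p x y) :
    inner ℝ y x - 1 = inner ℝ (y - e) (x - e) := by
  rw [inner_sub_left, inner_sub_right, inner_sub_right, h.inner_right, real_inner_comm e y,
    h.inner_left, real_inner_self_eq_norm_sq, he]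
  ring

theorem abs_inner_left_right_sub_one_le (he : ‖e‖ = 1) (h : IsDominantPair K e L η p x y) :
    |inner ℝ y x - 1| ≤ 36 * η ^ 2 := by
  rw [h.inner_left_right_sub_one he]
  have hη : 0 ≤ 6 * η := (norm_nonneg _).trans h.norm_left_sub_le
  calc |inner ℝ (y - e) (x - e)| ≤ ‖y - e‖ * ‖x - e‖ := abs_real_inner_le_norm _ _
    _ ≤ 6 * η * (6 * η) := by gcongr; exacts [h.norm_left_sub_le, h.norm_right_sub_le]
    _ = 36 * η ^ 2 := by ring

theorem inner_left_right_ne_zero (he : ‖e‖ = 1) (h : IsDominantPair K e L η p x y)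
    (hη : η ≤ 1 / 50) : inner ℝ y x ≠ 0 := fun h0 => by
  have hη0 : 0 ≤ 6 * η := (norm_nonneg _).trans h.norm_left_sub_le
  have := h.abs_inner_left_right_sub_one_le he
  rw [h0, zero_sub, abs_neg, abs_one] at this
  nlinarith

theorem inner_left_apply (h : IsDominantPair K e L η p x y) (z : H) :
    inner ℝ y (L z) = p * inner ℝ y z := by
  rw [← ContinuousLinearMap.adjoint_inner_left, h.left, real_inner_smul_left]

theorem pow_apply_right (h : IsDominantPair K e L η p x y) (m : ℕ) : (L ^ m) x = p ^ m • x := by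
  induction m with
  | zero => simp
  | succ m ih => rw [pow_succ', mul_apply_eq_comp, ih, map_smul, h.right, smul_smul, pow_succ]

theorem norm_apply_le_of_inner_eq_zero (hL : IsNearProjection K e L η)
    (h : IsDominantPair K e L η p x y) {z : H} (hz : inner ℝ y z = 0) :
    ‖L z‖ ≤ 7 * η * ‖z‖ := by
  have hez : |inner ℝ e z| ≤ 6 * η * ‖z‖ := by
    have : inner ℝ e z = -inner ℝ (y - e) z := by rw [inner_sub_left, hz]; ring
    rw [this, abs_neg]
    exact (abs_real_inner_le_norm _ _).trans (by gcongr; exact h.norm_left_sub_le)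
  calc ‖L z‖ ≤ ‖L z - inner ℝ e z • e‖ + ‖inner ℝ e z • e‖ := norm_le_norm_sub_add _ _
    _ ≤ η * ‖z‖ + 6 * η * ‖z‖ := by
        rw [norm_smul, hL.norm_eq_one, mul_one, Real.norm_eq_abs]
        exact add_le_add (hL.norm_apply_sub_le z) hez
    _ = 7 * η * ‖z‖ := by ring

theorem norm_pow_apply_le_of_inner_eq_zero (hL : IsNearProjection K e L η)
    (h : IsDominantPair K e L η p x y) {z : H} (hz : inner ℝ y z = 0) (m : ℕ) :
    ‖(L ^ m) z‖ ≤ (7 * η) ^ m * ‖z‖ := by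
  induction m generalizing z with
  | zero => simp
  | succ m ih =>
    have hη := hL.nonneg
    rw [pow_succ, mul_apply_eq_comp]
    calc ‖(L ^ m) (L z)‖ ≤ (7 * η) ^ m * ‖L z‖ := ih (by rw [h.inner_left_apply, hz, mul_zero])
      _ ≤ (7 * η) ^ m * (7 * η * ‖z‖) := by
          gcongr
          exact h.norm_apply_le_of_inner_eq_zero hL hz
      _ = (7 * η) ^ (m + 1) * ‖z‖ := by ring

theorem norm_left_le (he : ‖e‖ = 1) (h : IsDominantPair K e L η p x y) : ‖y‖ ≤ 1 + 6 * η := by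
  have := norm_le_norm_add_norm_sub' y e
  linarith [h.norm_left_sub_le]

theorem norm_right_le (he : ‖e‖ = 1) (h : IsDominantPair K e L η p x y) : ‖x‖ ≤ 1 + 6 * η := by
  have := norm_le_norm_add_norm_sub' x e
  linarith [h.norm_right_sub_le]

theorem abs_coeff_sub_one_le (he : ‖e‖ = 1) (h : IsDominantPair K e L η p x y)
    (hη : η ≤ 1 / 2000) {v : H} (hve : ‖v - e‖ ≤ 1 / 10) :
    |inner ℝ y v / inner ℝ y x - 1| ≤ 1 / 5 := by
  have hη0 : 0 ≤ 6 * η := (norm_nonneg _).trans h.norm_left_sub_le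
  have hyx := h.abs_inner_left_right_sub_one_le he
  have hyv : |inner ℝ y v - 1| ≤ (1 + 6 * η) * (1 / 10) := by
    have : inner ℝ y v - 1 = inner ℝ y (v - e) := by
      rw [inner_sub_right, real_inner_comm e y, h.inner_left]
    rw [this]
    exact (abs_real_inner_le_norm _ _).trans
      (mul_le_mul (h.norm_left_le he) hve (norm_nonneg _) (by linarith))
  rw [abs_le] at hyx hyv
  have hpos : 0 < inner ℝ y x := by nlinarith
  rw [div_sub_one hpos.ne', abs_div, abs_of_pos hpos, div_le_iff₀ hpos, abs_le]
  constructor <;> nlinarith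

/-- Since `L ^ 4` nearly projects onto the line of `x`, the eigenvector inherits being in `K` from
`L ^ 4 v`, up to the fourth power of the second eigenvalue. -/
theorem norm_orthogonal_proj_right_sub_le (hL : IsNearProjection K e L η)
    (h : IsDominantPair K e L η p x y) (hη : η ≤ 1 / 2000) {v : H} (hv : ‖v‖ = 1)
    (hve : ‖v - e‖ ≤ 1 / 10) (hLv : (L ^ 4) v ∈ K) :
    ‖Kᗮ.starProjection (x - e)‖ ≤ 8000 * η ^ 4 := by
  have hη0 := hL.nonneg
  have hyx := h.inner_left_right_ne_zero hL.norm_eq_one (hη.trans (by norm_num))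
  have ha := abs_le.1 (h.abs_coeff_sub_one_le hL.norm_eq_one hη hve)
  set a := inner ℝ y v / inner ℝ y x
  have hz : inner ℝ y (v - a • x) = 0 := by
    rw [inner_sub_right, real_inner_smul_right, div_mul_cancel₀ _ hyx, sub_self]
  have hznorm : ‖v - a • x‖ ≤ 5 / 2 := by
    refine (norm_sub_le _ _).trans ?_
    rw [norm_smul, hv, Real.norm_of_nonneg (by linarith)]
    nlinarith [h.norm_right_le hL.norm_eq_one, norm_nonneg x]
  have hproj : Kᗮ.starProjection ((L ^ 4) (v - a • x))
      = -((a * p ^ 4) • Kᗮ.starProjection (x - e)) := by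
    rw [map_sub, map_sub, map_smul, h.pow_apply_right, map_smul, map_smul, smul_smul, map_sub,
      Submodule.starProjection_orthogonal_apply_eq_zero hLv,
      Submodule.starProjection_orthogonal_apply_eq_zero hL.mem, zero_sub, sub_zero]
  have hp : 99 / 100 ≤ p ^ 4 := by
    have : 999 / 1000 ≤ p := by nlinarith [abs_le.1 h.abs_sub_one_le]
    calc (99 / 100 : ℝ) ≤ (999 / 1000) ^ 4 := by norm_num
      _ ≤ p ^ 4 := by gcongr
  have hbound : a * p ^ 4 * ‖Kᗮ.starProjection (x - e)‖ ≤ (7 * η) ^ 4 * (5 / 2) := by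
    calc a * p ^ 4 * ‖Kᗮ.starProjection (x - e)‖
        = ‖Kᗮ.starProjection ((L ^ 4) (v - a • x))‖ := by
          rw [hproj, norm_neg, norm_smul, Real.norm_of_nonneg]
          exact mul_nonneg (by linarith) (by linarith)
      _ ≤ ‖(L ^ 4) (v - a • x)‖ := Kᗮ.norm_starProjection_apply_le _
      _ ≤ (7 * η) ^ 4 * ‖v - a • x‖ := h.norm_pow_apply_le_of_inner_eq_zero hL hz 4
      _ ≤ (7 * η) ^ 4 * (5 / 2) := by gcongr
  have hap : 79 / 100 ≤ a * p ^ 4 := by nlinarith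
  have := mul_le_mul_of_nonneg_right hap (norm_nonneg (Kᗮ.starProjection (x - e)))
  rw [mul_pow] at hbound
  linarith [pow_nonneg hη0 4]

theorem abs_inv_inner_left_right_sub_one_le (hL : IsNearProjection K e L η)
    (h : IsDominantPair K e L η p x y) (hη : η ≤ 1 / 2000)
    (hx : ‖Kᗮ.starProjection (x - e)‖ ≤ 8000 * η ^ 4) :
    |(inner ℝ y x)⁻¹ - 1| ≤ 300 * η ^ 4 := by
  have hη0 := hL.nonneg
  have hyx : |inner ℝ y x - 1| ≤ 280 * η ^ 4 := by
    rw [h.inner_left_right_sub_one hL.norm_eq_one]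
    calc |inner ℝ (y - e) (x - e)|
        ≤ ‖K.starProjection (y - e)‖ * ‖K.starProjection (x - e)‖
            + ‖Kᗮ.starProjection (y - e)‖ * ‖Kᗮ.starProjection (x - e)‖ :=
          abs_inner_le_starProjection K _ _
      _ ≤ 16 * η ^ 2 * (16 * η ^ 2) + 6 * η * (8000 * η ^ 4) := by
          gcongr
          · exact h.norm_proj_left_sub_le
          · exact h.norm_proj_right_sub_le
          · exact (Kᗮ.norm_starProjection_apply_le _).trans h.norm_left_sub_le
      _ = (256 + 48000 * η) * η ^ 4 := by ring
      _ ≤ 280 * η ^ 4 := by gcongr; linarith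
  have hcoarse := abs_le.1 (h.abs_inner_left_right_sub_one_le hL.norm_eq_one)
  have hpos : 49 / 50 ≤ inner ℝ y x := by nlinarith
  have hinv : (inner ℝ y x)⁻¹ - 1 = -((inner ℝ y x - 1) / inner ℝ y x) := by
    field_simp
    ring
  rw [hinv, abs_neg, abs_div, abs_of_pos (by linarith : 0 < inner ℝ y x),
    div_le_iff₀ (by linarith)]
  nlinarith [pow_nonneg hη0 4]

theorem abs_inner_apply_sub_le (hL : IsNearProjection K e L η)
    (h : IsDominantPair K e L η p x y) (hη : η ≤ 1 / 2000)
    (hx : ‖Kᗮ.starProjection (x - e)‖ ≤ 8000 * η ^ 4) :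
    |inner ℝ e (L e) - p| ≤ 20 * η ^ 4 := by
  have hη0 := hL.nonneg
  rw [hL.inner_apply_sub h.right h.inner_right]
  calc |inner ℝ (e - L.adjoint e) (x - e)|
      ≤ ‖K.starProjection (e - L.adjoint e)‖ * ‖K.starProjection (x - e)‖
          + ‖Kᗮ.starProjection (e - L.adjoint e)‖ * ‖Kᗮ.starProjection (x - e)‖ :=
        abs_inner_le_starProjection K _ _
    _ ≤ η ^ 2 * (16 * η ^ 2) + η * (8000 * η ^ 4) := by
        gcongr
        · exact hL.norm_proj_adjoint_le
        · exact h.norm_proj_right_sub_le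
        · exact (Kᗮ.norm_starProjection_apply_le _).trans hL.adjoint.norm_sub_apply_le
    _ = (16 + 8000 * η) * η ^ 4 := by ring
    _ ≤ 20 * η ^ 4 := by gcongr; linarith

theorem norm_sub_smul_right_le (hL : IsNearProjection K e L η)
    (h : IsDominantPair K e L η p x y) (hη : η ≤ 1 / 2000)
    (hx : ‖Kᗮ.starProjection (x - e)‖ ≤ 8000 * η ^ 4) {c : ℝ} (hc : |c - 1| ≤ 300 * η ^ 4) :
    ‖e - c • x‖ ≤ 20 * η ^ 2 := by
  have hη0 := hL.nonneg
  have hη2 : η ^ 2 ≤ 1 / 2000 ^ 2 := by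
    calc η ^ 2 ≤ (1 / 2000) ^ 2 := by gcongr
      _ = 1 / 2000 ^ 2 := by norm_num
  have hsplit : e - c • x
      = -(K.starProjection (x - e) + Kᗮ.starProjection (x - e)) - (c - 1) • x := by
    rw [K.starProjection_add_starProjection_orthogonal, sub_smul, one_smul]
    abel
  calc ‖e - c • x‖
      ≤ ‖K.starProjection (x - e)‖ + ‖Kᗮ.starProjection (x - e)‖ + |c - 1| * ‖x‖ := by
        rw [hsplit, ← Real.norm_eq_abs, ← norm_smul]
        refine (norm_sub_le _ _).trans ?_
        rw [norm_neg]
        gcongr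
        exact norm_add_le _ _
    _ ≤ 16 * η ^ 2 + 8000 * η ^ 4 + 300 * η ^ 4 * 2 := by
        gcongr
        · exact h.norm_proj_right_sub_le
        · linarith [h.norm_right_le hL.norm_eq_one]
    _ = (16 + 8600 * η ^ 2) * η ^ 2 := by ring
    _ ≤ 20 * η ^ 2 := by gcongr; linarith

/- Split `e = c x + z` with `z` in the complementary invariant subspace: the first part contributes
`c p ^ m`, the second at most `(7 η) ^ m ‖z‖`. -/
theorem abs_inner_pow_apply_sub_pow_le (hL : IsNearProjection K e L η)
    (h : IsDominantPair K e L η p x y) (hη : η ≤ 1 / 2000) (hp : p ≤ 1)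
    (hx : ‖Kᗮ.starProjection (x - e)‖ ≤ 8000 * η ^ 4) (m : ℕ) :
    |inner ℝ e ((L ^ m) e) - p ^ m| ≤ 1300 * η ^ 4 := by
  have hη0 := hL.nonneg
  match m with
  | 0 => simpa [real_inner_self_eq_norm_sq, hL.norm_eq_one] using by positivity
  | 1 => simpa using (h.abs_inner_apply_sub_le hL hη hx).trans (by gcongr; norm_num)
  | m + 2 =>
    set c := (inner ℝ y x)⁻¹
    have hyx := h.inner_left_right_ne_zero hL.norm_eq_one (hη.trans (by norm_num))
    have hc : |c - 1| ≤ 300 * η ^ 4 := h.abs_inv_inner_left_right_sub_one_le hL hη hx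
    have hz : inner ℝ y (e - c • x) = 0 := by
      rw [inner_sub_right, real_inner_smul_right, inv_mul_cancel₀ hyx, real_inner_comm,
        h.inner_left, sub_self]
    have hsplit : inner ℝ e ((L ^ (m + 2)) e) - p ^ (m + 2)
        = (c - 1) * p ^ (m + 2) + inner ℝ e ((L ^ (m + 2)) (e - c • x)) := by
      rw [map_sub, map_smul, h.pow_apply_right, inner_sub_right, real_inner_smul_right,
        real_inner_smul_right, h.inner_right]
      ring
    have hp0 : 0 ≤ p := by nlinarith [abs_le.1 h.abs_sub_one_le]
    have hpow : (7 * η) ^ (m + 2) ≤ (7 * η) ^ 2 :=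
      pow_le_pow_of_le_one (by linarith) (by linarith) (by omega)
    rw [hsplit]
    calc |(c - 1) * p ^ (m + 2) + inner ℝ e ((L ^ (m + 2)) (e - c • x))|
        ≤ |c - 1| * p ^ (m + 2) + ‖(L ^ (m + 2)) (e - c • x)‖ := by
          refine (abs_add_le _ _).trans (add_le_add ?_ ?_)
          · rw [abs_mul, abs_of_nonneg (pow_nonneg hp0 _)]
          · simpa [hL.norm_eq_one] using abs_real_inner_le_norm e ((L ^ (m + 2)) (e - c • x))
      _ ≤ 300 * η ^ 4 * 1 + (7 * η) ^ 2 * (20 * η ^ 2) := by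
          gcongr
          · exact pow_le_one₀ hp0 hp
          · exact (h.norm_pow_apply_le_of_inner_eq_zero hL hz _).trans
              (mul_le_mul hpow (h.norm_sub_smul_right_le hL hη hx hc) (norm_nonneg _)
                (by positivity))
      _ ≤ 1300 * η ^ 4 := by nlinarith [pow_nonneg hη0 4]

/-- Any eigenvalue other than `p` belongs to the complementary invariant subspace, where `L` is of
norm at most `7 η`. -/
theorem eq_of_apply_eq_smul (hL : IsNearProjection K e L η)
    (h : IsDominantPair K e L η p x y) {q : ℝ} {z : H} (hz : L z = q • z) (hz0 : z ≠ 0)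
    (hq : 7 * η < q) : q = p := by
  by_contra hne
  have hyz : inner ℝ y z = 0 := by
    have := h.inner_left_apply z
    rw [hz, real_inner_smul_right] at this
    exact (mul_eq_mul_right_iff.1 this).resolve_left hne
  have := h.norm_apply_le_of_inner_eq_zero hL hyz
  rw [hz, norm_smul, Real.norm_of_nonneg (by linarith [hL.nonneg])] at this
  exact absurd this (not_le.2 (mul_lt_mul_of_pos_right hq (norm_pos_iff.2 hz0)))

theorem sq_add_sq_le_of_complex_eigenvector (hL : IsNearProjection K e L η)
    (h : IsDominantPair K e L η p x y) (hp : 7 * η ≤ p) {r s : ℝ} {u v : H}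
    (hu : L u = r • u - s • v) (hv : L v = s • u + r • v) (huv : u ≠ 0 ∨ v ≠ 0) :
    r ^ 2 + s ^ 2 ≤ p ^ 2 := by
  have := hL.nonneg
  have hyu := h.inner_left_apply u
  have hyv := h.inner_left_apply v
  rw [hu, inner_sub_right, real_inner_smul_right, real_inner_smul_right] at hyu
  rw [hv, inner_add_right, real_inner_smul_right, real_inner_smul_right] at hyv
  by_cases h0 : inner ℝ y u = 0 ∧ inner ℝ y v = 0
  · have hpos : 0 < ‖u‖ ^ 2 + ‖v‖ ^ 2 := by
      rcases huv.imp norm_pos_iff.2 norm_pos_iff.2 with hu0 | hv0 <;> positivity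
    refine le_of_mul_le_mul_right ?_ hpos
    calc (r ^ 2 + s ^ 2) * (‖u‖ ^ 2 + ‖v‖ ^ 2)
        = ‖L u‖ ^ 2 + ‖L v‖ ^ 2 := by rw [hu, hv, norm_sq_add_norm_sq_rotation]
      _ ≤ (p * ‖u‖) ^ 2 + (p * ‖v‖) ^ 2 := by
          gcongr
          · exact (h.norm_apply_le_of_inner_eq_zero hL h0.1).trans (by gcongr)
          · exact (h.norm_apply_le_of_inner_eq_zero hL h0.2).trans (by gcongr)
      _ = p ^ 2 * (‖u‖ ^ 2 + ‖v‖ ^ 2) := by ring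
  · have hpos : 0 < inner ℝ y u ^ 2 + inner ℝ y v ^ 2 := by
      rcases not_and_or.1 h0 with h0 | h0 <;> positivity
    refine (mul_right_cancel₀ hpos.ne' ?_).le
    linear_combination (p * inner ℝ y u + r * inner ℝ y u - s * inner ℝ y v) * hyu
      + (p * inner ℝ y v + s * inner ℝ y u + r * inner ℝ y v) * hyv

end IsDominantPair

end Perturbation

/-! ### Noisy twirls -/

section FrobeniusInner

variable {n : Type*} [Fintype n]

open scoped MatrixOrder Matrix.Norms.L2Operator in
theorem exists_eq_transpose_mul_of_posSemidef {S : Matrix n n ℝ} (hS : S.PosSemidef) :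
    ∃ B : Matrix n n ℝ, S = Bᵀ * B := by
  classical
  obtain ⟨B, rfl⟩ := CStarAlgebra.nonneg_iff_eq_star_mul_self.mp hS.nonneg
  exact ⟨B, by rw [star_eq_conjTranspose, conjTranspose_eq_transpose_of_trivial]⟩

attribute [local instance] frobeniusNormedAddCommGroup frobeniusNormedSpace

theorem trace_transpose_mul_self (A : Matrix n n ℝ) : (Aᵀ * A).trace = ‖A‖ ^ 2 := by
  rw [frobenius_norm_def, ← Real.sqrt_eq_rpow, Real.sq_sqrt (by positivity), Matrix.trace,
    Finset.sum_comm]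
  simp [mul_apply, sq]

/-- The inner product `⟨A, B⟩ = tr (Aᵀ B)`, which induces the Frobenius norm. -/
@[reducible] def frobeniusInner : InnerProductSpace ℝ (Matrix n n ℝ) where
  inner A B := (Aᵀ * B).trace
  norm_sq_eq_re_inner A := (trace_transpose_mul_self A).symm
  conj_inner_symm A B := by
    rw [conj_trivial, ← trace_transpose, transpose_mul, transpose_transpose]
  add_left A B C := by rw [transpose_add, Matrix.add_mul, trace_add]
  smul_left A B r := by simp

attribute [local instance] frobeniusInner

/-- The topology of the Frobenius norm. It has to take precedence over the product topology on
matrices, which is equal to it but not reducibly so. -/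
@[reducible] def frobeniusTopology : TopologicalSpace (Matrix n n ℝ) :=
  PseudoMetricSpace.toUniformSpace.toTopologicalSpace

attribute [local instance] frobeniusTopology

theorem inner_eq_trace (A B : Matrix n n ℝ) : inner ℝ A B = (Aᵀ * B).trace := rfl

theorem norm_orthogonal_mul [DecidableEq n] {Q : Matrix n n ℝ} (hQ : Qᵀ * Q = 1)
    (X : Matrix n n ℝ) : ‖Q * X‖ = ‖X‖ := by
  rw [← sq_eq_sq₀ (norm_nonneg _) (norm_nonneg _), ← trace_transpose_mul_self,
    ← trace_transpose_mul_self, transpose_mul, Matrix.mul_assoc, ← Matrix.mul_assoc Qᵀ, hQ,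
    Matrix.one_mul]

theorem norm_one_sq [DecidableEq n] : ‖(1 : Matrix n n ℝ)‖ ^ 2 = Fintype.card n := by
  rw [← trace_transpose_mul_self]; simp

theorem norm_one_eq [DecidableEq n] : ‖(1 : Matrix n n ℝ)‖ = √(Fintype.card n) := by
  rw [← norm_one_sq, Real.sqrt_sq (norm_nonneg _)]

theorem norm_orthogonal [DecidableEq n] {Q : Matrix n n ℝ} (hQ : Qᵀ * Q = 1) :
    ‖Q‖ = √(Fintype.card n) := by
  rw [← norm_one_eq, ← norm_orthogonal_mul hQ 1, Matrix.mul_one]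

theorem abs_trace_le (A : Matrix n n ℝ) : |A.trace| ≤ √(Fintype.card n) * ‖A‖ := by
  classical
  have h := abs_real_inner_le_norm 1 A
  rwa [inner_eq_trace, transpose_one, Matrix.one_mul, norm_one_eq] at h

theorem norm_le_trace_of_posSemidef {S : Matrix n n ℝ} (hS : S.PosSemidef) : ‖S‖ ≤ S.trace := by
  obtain ⟨B, rfl⟩ := exists_eq_transpose_mul_of_posSemidef hS
  calc ‖Bᵀ * B‖ ≤ ‖Bᵀ‖ * ‖B‖ := frobenius_norm_mul _ _
    _ = (Bᵀ * B).trace := by rw [frobenius_norm_transpose, trace_transpose_mul_self, sq]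

/-- The subspace of symmetric matrices. -/
def symmetricMatrices (n : Type*) : Submodule ℝ (Matrix n n ℝ) where
  carrier := {A | Aᵀ = A}
  add_mem' hA hB := by rw [Set.mem_ofPred_eq, transpose_add, hA, hB]
  zero_mem' := transpose_zero
  smul_mem' c A hA := by rw [Set.mem_ofPred_eq, transpose_smul, hA]

theorem mem_symmetricMatrices {n : Type*} {A : Matrix n n ℝ} : A ∈ symmetricMatrices n ↔ Aᵀ = A :=
  Iff.rfl

theorem completeSpace_matrix :
    @CompleteSpace (Matrix n n ℝ) PseudoMetricSpace.toUniformSpace :=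
  FiniteDimensional.complete ℝ _

attribute [local instance] completeSpace_matrix

theorem starProjection_symmetricMatrices (A : Matrix n n ℝ) :
    (symmetricMatrices n).starProjection A = (1 / 2 : ℝ) • (A + Aᵀ) := by
  refine Submodule.eq_starProjection_of_mem_orthogonal ?_ ?_
  · rw [mem_symmetricMatrices, transpose_smul, transpose_add, transpose_transpose, add_comm]
  · refine (Submodule.mem_orthogonal _ _).2 fun S hS => ?_
    have h : (S * Aᵀ).trace = (S * A).trace := by
      rw [← trace_transpose, transpose_mul, transpose_transpose, mem_symmetricMatrices.1 hS,
        trace_mul_comm]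
    rw [inner_eq_trace, mem_symmetricMatrices.1 hS, Matrix.mul_sub, Matrix.mul_smul,
      Matrix.mul_add, trace_sub, trace_smul, trace_add, h, smul_eq_mul]
    ring

/-- A matrix that does not increase the Euclidean length of any vector. -/
def IsContraction (A : Matrix n n ℝ) : Prop := ∀ x : n → ℝ, (A *ᵥ x) ⬝ᵥ (A *ᵥ x) ≤ x ⬝ᵥ x

namespace IsContraction

variable {A : Matrix n n ℝ}

theorem transpose (hA : IsContraction A) : IsContraction Aᵀ := by
  intro x
  have hadj : x ⬝ᵥ (A *ᵥ (Aᵀ *ᵥ x)) = (Aᵀ *ᵥ x) ⬝ᵥ (Aᵀ *ᵥ x) := by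
    rw [dotProduct_mulVec, ← mulVec_transpose]
  have hsq := dotProduct_star_self_nonneg (x - A *ᵥ (Aᵀ *ᵥ x))
  rw [star_trivial, sub_dotProduct, dotProduct_sub, dotProduct_sub, dotProduct_comm (A *ᵥ _) x,
    hadj] at hsq
  linarith [hA (Aᵀ *ᵥ x)]

theorem norm_mul_le (hA : IsContraction A) (X : Matrix n n ℝ) : ‖A * X‖ ≤ ‖X‖ := by
  have hcol (B : Matrix n n ℝ) : ‖B‖ ^ 2 = ∑ j, B.col j ⬝ᵥ B.col j := by
    simp [← trace_transpose_mul_self, Matrix.trace, mul_apply, dotProduct]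
  rw [← sq_le_sq₀ (norm_nonneg _) (norm_nonneg _), hcol, hcol]
  exact Finset.sum_le_sum fun j _ => hA (X.col j)

theorem norm_mul_le' (hA : IsContraction A) (X : Matrix n n ℝ) : ‖X * A‖ ≤ ‖X‖ := by
  rw [← frobenius_norm_transpose, transpose_mul, ← frobenius_norm_transpose X]
  exact hA.transpose.norm_mul_le Xᵀ

theorem orthogonal_mul [DecidableEq n] (hA : IsContraction A) {Q : Matrix n n ℝ}
    (hQ : Qᵀ * Q = 1) : IsContraction (Q * A) := by
  intro x
  rw [← mulVec_mulVec, dotProduct_mulVec, ← mulVec_transpose, mulVec_mulVec, hQ, one_mulVec]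
  exact hA x

theorem norm_symmetric_part_one_sub_le [DecidableEq n] (hA : IsContraction A) :
    ‖(symmetricMatrices n).starProjection (1 - A)‖ ≤ (1 - A).trace := by
  rw [starProjection_symmetricMatrices]
  have hps : ((1 / 2 : ℝ) • ((1 - A) + (1 - A)ᵀ)).PosSemidef := by
    refine .of_dotProduct_mulVec_nonneg ?_ fun x => ?_
    · rw [IsHermitian, conjTranspose_eq_transpose_of_trivial, transpose_smul, transpose_add,
        transpose_transpose, add_comm]
    · have hsq := dotProduct_star_self_nonneg (x - A *ᵥ x)
      rw [star_trivial, sub_dotProduct, dotProduct_sub, dotProduct_sub,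
        dotProduct_comm (A *ᵥ x) x] at hsq
      rw [star_trivial, smul_mulVec, dotProduct_smul, add_mulVec, dotProduct_add,
        mulVec_transpose, dotProduct_comm x (x ᵥ* _), ← dotProduct_mulVec, sub_mulVec, one_mulVec,
        dotProduct_sub, smul_eq_mul]
      linarith [hA x]
  refine (norm_le_trace_of_posSemidef hps).trans_eq ?_
  rw [trace_smul, trace_add, trace_transpose, smul_eq_mul]
  ring

end IsContraction

section Twirl

variable {ι : Type*} [Fintype ι] {R B : ι → Matrix n n ℝ}

theorem norm_expect_le {E : Type*} [NormedAddCommGroup E] [NormedSpace ℝ E] [Module ℚ≥0 E]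
    (f : ι → E) : ‖𝔼 i, f i‖ ≤ 𝔼 i, ‖f i‖ :=
  Finset.le_expect_of_subadditive norm_zero norm_add_le fun k x => by
    rw [← NNRat.cast_smul_eq_nnqsmul ℝ, norm_smul, Real.norm_of_nonneg (NNRat.cast_nonneg _),
      ← NNRat.cast_smul_eq_nnqsmul ℝ, smul_eq_mul]

theorem linearMap_expect {E F : Type*} [AddCommGroup E] [Module ℝ E] [Module ℚ≥0 E]
    [AddCommGroup F] [Module ℝ F] [Module ℚ≥0 F] (g : E →ₗ[ℝ] F) (f : ι → E) :
    g (𝔼 i, f i) = 𝔼 i, g (f i) :=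
  map_expect (g.restrictScalars ℚ≥0) f Finset.univ

theorem sq_expect_le_expect_sq [Nonempty ι] (f : ι → ℝ) : (𝔼 i, f i) ^ 2 ≤ 𝔼 i, f i ^ 2 := by
  simpa using Finset.expect_mul_sq_le_sq_mul_sq Finset.univ f 1

/-- The superoperator `X ↦ E[Rᵀ X B]`. -/
def noisyTwirl (R B : ι → Matrix n n ℝ) : Matrix n n ℝ →L[ℝ] Matrix n n ℝ :=
  LinearMap.toContinuousLinearMap
    { toFun := fun X => 𝔼 i, (R i)ᵀ * X * B i
      map_add' := fun X Y => by simp [Matrix.mul_add, Matrix.add_mul, Finset.expect_add_distrib]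
      map_smul' := fun c X => by simp [Finset.smul_expect] }

theorem noisyTwirl_apply (X : Matrix n n ℝ) : noisyTwirl R B X = 𝔼 i, (R i)ᵀ * X * B i := rfl

theorem adjoint_noisyTwirl :
    (noisyTwirl R B).adjoint = noisyTwirl (fun i => (R i)ᵀ) (fun i => (B i)ᵀ) := by
  refine ((ContinuousLinearMap.eq_adjoint_iff _ _).2 fun X Y => ?_).symm
  have hL := linearMap_expect (innerₛₗ ℝ Y) fun i => (R i)ᵀᵀ * X * (B i)ᵀ
  have hR := linearMap_expect (innerₛₗ ℝ X) fun i => (R i)ᵀ * Y * B i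
  simp only [innerₛₗ_apply_apply] at hL hR
  rw [noisyTwirl_apply, noisyTwirl_apply, real_inner_comm, hL, hR]
  refine Finset.expect_congr rfl fun i _ => ?_
  rw [real_inner_comm, inner_eq_trace, inner_eq_trace, transpose_mul, transpose_mul,
    transpose_transpose, transpose_transpose, Matrix.mul_assoc (B i), trace_mul_comm (B i)]
  simp only [Matrix.mul_assoc]

theorem noisyTwirl_conj (O X : Matrix n n ℝ) :
    noisyTwirl (fun i => O * R i * Oᵀ) B X = O * noisyTwirl R B (Oᵀ * X) := by
  classical
  simp only [noisyTwirl_apply, Finset.mul_expect, transpose_mul, transpose_transpose,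
    Matrix.mul_assoc]

variable [DecidableEq n]

/-- The average infidelity `E[tr (1 - Rᵀ B)]` of `B` with respect to `R`. -/
def twirlDefect (R B : ι → Matrix n n ℝ) : ℝ := 𝔼 i, (1 - (R i)ᵀ * B i).trace

theorem twirlDefect_transpose :
    twirlDefect (fun i => (R i)ᵀ) (fun i => (B i)ᵀ) = twirlDefect R B := by
  refine Finset.expect_congr rfl fun i _ => ?_
  rw [trace_sub, trace_sub, ← trace_transpose ((R i)ᵀᵀ * _), transpose_mul, trace_mul_comm]
  simp

theorem trace_noisyTwirl_one [Nonempty ι] :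
    (noisyTwirl R B 1).trace = Fintype.card n - twirlDefect R B := by
  have htrace := linearMap_expect (traceLinearMap n ℝ ℝ) fun i => (R i)ᵀ * 1 * B i
  simp only [traceLinearMap_apply, Matrix.mul_one] at htrace
  simp only [noisyTwirl_apply, Matrix.mul_one, twirlDefect, htrace, trace_sub,
    Finset.expect_sub_distrib, Fintype.expect_const, trace_one]
  ring

theorem norm_sub_sq_le_of_isContraction {Q A : Matrix n n ℝ} (hQ : Qᵀ * Q = 1)
    (hA : IsContraction A) : ‖A - Q‖ ^ 2 ≤ 2 * (1 - Qᵀ * A).trace := by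
  have hA1 : ‖A‖ ^ 2 ≤ Fintype.card n := by
    rw [← norm_one_sq]
    have := hA.norm_mul_le 1
    rw [Matrix.mul_one] at this
    gcongr
  have hQ1 : ‖Q‖ ^ 2 = Fintype.card n := by
    rw [norm_orthogonal hQ, Real.sq_sqrt (Nat.cast_nonneg _)]
  rw [@norm_sub_sq_real, real_inner_comm, inner_eq_trace, trace_sub, trace_one]
  linarith

theorem norm_symmetric_part_one_sub_noisyTwirl_le [Nonempty ι] (hR : ∀ i, (R i)ᵀ * R i = 1)
    (hB : ∀ i, IsContraction (B i)) :
    ‖(symmetricMatrices n).starProjection (1 - noisyTwirl R B 1)‖ ≤ twirlDefect R B := by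
  have h1 : 1 - noisyTwirl R B 1 = 𝔼 i, (1 - (R i)ᵀ * B i) := by
    simp [noisyTwirl_apply, Finset.expect_sub_distrib]
  have hproj := linearMap_expect (symmetricMatrices n).starProjection.toLinearMap
    fun i => 1 - (R i)ᵀ * B i
  simp only [ContinuousLinearMap.coe_coe] at hproj
  rw [h1, hproj, twirlDefect]
  refine (norm_expect_le _).trans (Finset.expect_le_expect fun i _ => ?_)
  refine ((hB i).orthogonal_mul ?_).norm_symmetric_part_one_sub_le
  rw [transpose_transpose, mul_eq_one_comm.1 (hR i)]

open InnerProductSpace in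
theorem rankOne_normalized_one_apply [Nonempty n] (X : Matrix n n ℝ) :
    rankOne ℝ ((√(Fintype.card n))⁻¹ • (1 : Matrix n n ℝ)) ((√(Fintype.card n))⁻¹ • 1) X =
      (X.trace / (Fintype.card n : ℝ)) • (1 : Matrix n n ℝ) := by
  have hsq : √(Fintype.card n) ^ 2 = (Fintype.card n : ℝ) := Real.sq_sqrt (by positivity)
  rw [rankOne_apply, inner_eq_trace, transpose_smul, transpose_one, Matrix.smul_mul,
    Matrix.one_mul, trace_smul, smul_smul, smul_eq_mul]
  congr 1
  field_simp
  rw [hsq, mul_comm]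

theorem sqrt_two_mul_twirlDefect_le (hδ : 8 * 10 ^ 6 * twirlDefect R B ≤ 1) :
    √(2 * twirlDefect R B) ≤ 1 / 2000 :=
  Real.sqrt_le_iff.2 ⟨by norm_num, by linarith⟩

/-- `R` is a family of orthogonal matrices whose twirl `X ↦ E[Rᵀ X R]` is that of the Haar measure,
and `B` is a noisy version of it made of contractions. -/
structure IsNoisyDesign (R B : ι → Matrix n n ℝ) : Prop where
  orthogonal : ∀ i, (R i)ᵀ * R i = 1
  isContraction : ∀ i, IsContraction (B i)
  twirl_eq : ∀ X, 𝔼 i, (R i)ᵀ * X * R i = (X.trace / (Fintype.card n : ℝ)) • (1 : Matrix n n ℝ)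

namespace IsNoisyDesign

theorem norm_noisyTwirl_le [Nonempty ι] (h : IsNoisyDesign R B) (X : Matrix n n ℝ) :
    ‖noisyTwirl R B X‖ ≤ ‖X‖ := by
  rw [noisyTwirl_apply]
  refine (norm_expect_le _).trans (Finset.expect_le Finset.univ_nonempty fun i _ => ?_)
  refine ((h.isContraction i).norm_mul_le' _).trans (norm_orthogonal_mul ?_ X).le
  rw [transpose_transpose, mul_eq_one_comm.1 (h.orthogonal i)]

theorem expect_norm_sub_le [Nonempty ι] (h : IsNoisyDesign R B) :
    𝔼 i, ‖B i - R i‖ ≤ √(2 * twirlDefect R B) := by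
  refine Real.le_sqrt_of_sq_le ((sq_expect_le_expect_sq _).trans ?_)
  rw [twirlDefect, Finset.mul_expect]
  exact Finset.expect_le_expect fun i _ =>
    norm_sub_sq_le_of_isContraction (h.orthogonal i) (h.isContraction i)

theorem norm_noisyTwirl_sub_le [Nonempty ι] (h : IsNoisyDesign R B) (X : Matrix n n ℝ) :
    ‖noisyTwirl R B X - (X.trace / (Fintype.card n : ℝ)) • (1 : Matrix n n ℝ)‖ ≤
      √(2 * twirlDefect R B) * ‖X‖ := by
  rw [← h.twirl_eq X, noisyTwirl_apply, ← Finset.expect_sub_distrib]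
  calc ‖𝔼 i, ((R i)ᵀ * X * B i - (R i)ᵀ * X * R i)‖
      ≤ 𝔼 i, ‖(R i)ᵀ * X * B i - (R i)ᵀ * X * R i‖ := norm_expect_le _
    _ ≤ 𝔼 i, ‖B i - R i‖ * ‖X‖ := Finset.expect_le_expect fun i _ => by
        have hR : (R i)ᵀᵀ * (R i)ᵀ = 1 := by
          rw [transpose_transpose, mul_eq_one_comm.1 (h.orthogonal i)]
        rw [← Matrix.mul_sub, Matrix.mul_assoc, norm_orthogonal_mul hR, mul_comm]
        exact frobenius_norm_mul _ _
    _ ≤ √(2 * twirlDefect R B) * ‖X‖ := by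
        rw [← Finset.expect_mul]
        gcongr
        exact h.expect_norm_sub_le

theorem twirlDefect_nonneg (h : IsNoisyDesign R B) : 0 ≤ twirlDefect R B :=
  Finset.expect_nonneg fun i _ => by
    linarith [sq_nonneg ‖B i - R i‖,
      norm_sub_sq_le_of_isContraction (h.orthogonal i) (h.isContraction i)]

theorem isNearProjection [Nonempty ι] [Nonempty n] (h : IsNoisyDesign R B) :
    IsNearProjection (symmetricMatrices n) ((√(Fintype.card n))⁻¹ • 1) (noisyTwirl R B)
      √(2 * twirlDefect R B) := by
  have hd : (1 : ℝ) ≤ Fintype.card n := by exact_mod_cast Fintype.card_pos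
  have hinv : (√(Fintype.card n))⁻¹ ≤ 1 := inv_le_one_of_one_le₀ (Real.one_le_sqrt.2 hd)
  have hδ := h.twirlDefect_nonneg
  have hη : √(2 * twirlDefect R B) ^ 2 = 2 * twirlDefect R B := Real.sq_sqrt (by positivity)
  have hproj (S C : ι → Matrix n n ℝ) (hS : ∀ i, (S i)ᵀ * S i = 1)
      (hC : ∀ i, IsContraction (C i)) (hSC : twirlDefect S C = twirlDefect R B) :
      ‖(symmetricMatrices n).starProjection ((√(Fintype.card n))⁻¹ • 1 -
        noisyTwirl S C ((√(Fintype.card n))⁻¹ • 1))‖ ≤ √(2 * twirlDefect R B) ^ 2 := by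
    have hle := norm_symmetric_part_one_sub_noisyTwirl_le hS hC
    rw [map_smul, ← smul_sub, map_smul, norm_smul, Real.norm_of_nonneg (by positivity), hη]
    rw [hSC] at hle
    nlinarith [mul_le_mul hinv hle (norm_nonneg _) zero_le_one]
  refine ⟨?_, ?_, ?_, hproj R B h.orthogonal h.isContraction rfl, ?_⟩
  · rw [norm_smul, norm_one_eq, Real.norm_of_nonneg (by positivity),
      inv_mul_cancel₀ (by positivity)]
  · rw [mem_symmetricMatrices, transpose_smul, transpose_one]
  · refine ContinuousLinearMap.opNorm_le_bound _ (Real.sqrt_nonneg _) fun X => ?_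
    rw [_root_.sub_apply, rankOne_normalized_one_apply]
    exact h.norm_noisyTwirl_sub_le X
  · rw [adjoint_noisyTwirl]
    refine hproj _ _ (fun i => ?_) (fun i => (h.isContraction i).transpose) twirlDefect_transpose
    rw [transpose_transpose, mul_eq_one_comm.1 (h.orthogonal i)]

theorem norm_one_sub_noisyTwirl_pow_one_le [Nonempty ι] [Nonempty n] (h : IsNoisyDesign R B)
    (m : ℕ) : ‖1 - (noisyTwirl R B ^ m) 1‖ ≤
      m * (√(Fintype.card n) * √(2 * twirlDefect R B)) := by
  have hstep : ‖1 - noisyTwirl R B 1‖ ≤ √(Fintype.card n) * √(2 * twirlDefect R B) := by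
    have := h.norm_noisyTwirl_sub_le 1
    rw [trace_one, div_self (by positivity), one_smul, norm_one_eq] at this
    rwa [norm_sub_rev, mul_comm]
  induction m with
  | zero => simp
  | succ m ih =>
    have hsplit : 1 - (noisyTwirl R B ^ (m + 1)) 1 =
        (1 - noisyTwirl R B 1) + noisyTwirl R B (1 - (noisyTwirl R B ^ m) 1) := by
      rw [pow_succ', mul_apply_eq_comp, map_sub]; abel
    rw [hsplit]
    rw [Nat.cast_succ]
    linarith [norm_add_le (1 - noisyTwirl R B 1) (noisyTwirl R B (1 - (noisyTwirl R B ^ m) 1)),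
      h.norm_noisyTwirl_le (1 - (noisyTwirl R B ^ m) 1)]

end IsNoisyDesign

section Gauge

variable {O : Matrix n n ℝ}

theorem noisyTwirl_conj_pow (hO : Oᵀ * O = 1) (m : ℕ) (X : Matrix n n ℝ) :
    (noisyTwirl (fun i => O * R i * Oᵀ) B ^ m) X = O * (noisyTwirl R B ^ m) (Oᵀ * X) := by
  induction m with
  | zero => simp [← Matrix.mul_assoc, mul_eq_one_comm.1 hO]
  | succ m ih =>
    rw [pow_succ', pow_succ', mul_apply_eq_comp, mul_apply_eq_comp, ih, noisyTwirl_conj,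
      ← Matrix.mul_assoc, hO, Matrix.one_mul]

namespace IsNoisyDesign

theorem conj (h : IsNoisyDesign R B) (hO : Oᵀ * O = 1) :
    IsNoisyDesign (fun i => O * R i * Oᵀ) B where
  orthogonal i := by
    calc (O * R i * Oᵀ)ᵀ * (O * R i * Oᵀ) = O * ((R i)ᵀ * ((Oᵀ * O) * R i)) * Oᵀ := by
          simp only [transpose_mul, transpose_transpose, Matrix.mul_assoc]
      _ = 1 := by
          rw [hO, Matrix.one_mul, h.orthogonal, Matrix.mul_one, mul_eq_one_comm.1 hO]
  isContraction := h.isContraction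
  twirl_eq X := by
    have hconj (i : ι) : (O * R i * Oᵀ)ᵀ * X * (O * R i * Oᵀ) =
        O * ((R i)ᵀ * (Oᵀ * X * O) * R i) * Oᵀ := by
      simp only [transpose_mul, transpose_transpose, Matrix.mul_assoc]
    simp only [hconj]
    rw [← Finset.expect_mul, ← Finset.mul_expect, h.twirl_eq, trace_mul_comm, ← Matrix.mul_assoc,
      mul_eq_one_comm.1 hO, Matrix.one_mul, Matrix.mul_smul, Matrix.smul_mul, Matrix.mul_one,
      mul_eq_one_comm.1 hO]

theorem twirlDefect_conj_le [Nonempty ι] [Nonempty n] (h : IsNoisyDesign R B) (hO : Oᵀ * O = 1) :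
    twirlDefect (fun i => O * R i * Oᵀ) B ≤ twirlDefect R B + 2 * Fintype.card n * ‖O - 1‖ := by
  have htr := trace_noisyTwirl_one (R := R) (B := B)
  have htr' := trace_noisyTwirl_one (R := fun i => O * R i * Oᵀ) (B := B)
  rw [noisyTwirl_conj, Matrix.mul_one] at htr'
  have hsplit : noisyTwirl R B 1 - O * noisyTwirl R B Oᵀ =
      - ((O - 1) * noisyTwirl R B Oᵀ + noisyTwirl R B (Oᵀ - 1)) := by
    rw [map_sub, Matrix.sub_mul, Matrix.one_mul]; abel
  have hO1 : ‖Oᵀ - 1‖ = ‖O - 1‖ := by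
    rw [← frobenius_norm_transpose, transpose_sub, transpose_transpose, transpose_one]
  have hL : ‖noisyTwirl R B Oᵀ‖ ≤ √(Fintype.card n) := by
    refine (h.norm_noisyTwirl_le _).trans_eq ?_
    rw [frobenius_norm_transpose, norm_orthogonal hO]
  have hnorm : ‖noisyTwirl R B 1 - O * noisyTwirl R B Oᵀ‖ ≤
      ‖O - 1‖ * √(Fintype.card n) + ‖O - 1‖ := by
    rw [hsplit, norm_neg]
    refine (norm_add_le _ _).trans (add_le_add ?_ ((h.norm_noisyTwirl_le _).trans_eq hO1))
    exact (frobenius_norm_mul _ _).trans (by gcongr)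
  have habs := (le_abs_self _).trans (abs_trace_le (noisyTwirl R B 1 - O * noisyTwirl R B Oᵀ))
  rw [trace_sub] at habs
  have hd : 1 ≤ √(Fintype.card n) := Real.one_le_sqrt.2 (by exact_mod_cast Fintype.card_pos)
  have hsq : √(Fintype.card n) * √(Fintype.card n) = (Fintype.card n : ℝ) :=
    Real.mul_self_sqrt (by positivity)
  have hle : √(Fintype.card n) ≤ Fintype.card n :=
    (le_mul_of_one_le_right (Real.sqrt_nonneg _) hd).trans_eq hsq
  have hscaled := calc √(Fintype.card n) * ‖noisyTwirl R B 1 - O * noisyTwirl R B Oᵀ‖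
      _ ≤ √(Fintype.card n) * (‖O - 1‖ * √(Fintype.card n) + ‖O - 1‖) := by gcongr
      _ = (Fintype.card n + √(Fintype.card n)) * ‖O - 1‖ := by linear_combination ‖O - 1‖ * hsq
      _ ≤ (Fintype.card n + Fintype.card n) * ‖O - 1‖ := by gcongr
  linarith

theorem eigenvalue_le_one [Nonempty ι] (h : IsNoisyDesign R B) {p : ℝ} {X : Matrix n n ℝ}
    (hX : noisyTwirl R B X = p • X) (hX0 : X ≠ 0) : p ≤ 1 := by
  have hle := h.norm_noisyTwirl_le X
  rw [hX, norm_smul] at hle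
  exact (le_abs_self p).trans ((mul_le_iff_le_one_left (norm_pos_iff.2 hX0)).1 hle)

theorem abs_trace_pow_one_sub_pow_le_sq_twirlDefect [Nonempty ι] [Nonempty n]
    (h : IsNoisyDesign R B) (hδ : 8 * 10 ^ 6 * twirlDefect R B ≤ 1) (hO : Oᵀ * O = 1)
    (hO1 : ‖O - 1‖ ≤ 1 / 10) (hsym : (noisyTwirl R B ^ 4) O ∈ symmetricMatrices n) {p : ℝ}
    {X : Matrix n n ℝ} (hX : noisyTwirl R B X = p • X) (hX0 : X ≠ 0) (hp : 1 / 2 ≤ p) (m : ℕ) :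
    |((noisyTwirl R B ^ m) 1).trace / Fintype.card n - p ^ m| ≤ 5200 * twirlDefect R B ^ 2 := by
  have hη := sqrt_two_mul_twirlDefect_le hδ
  have hη2 : √(2 * twirlDefect R B) ^ 2 = 2 * twirlDefect R B :=
    Real.sq_sqrt (mul_nonneg zero_le_two h.twirlDefect_nonneg)
  have hd : 1 ≤ √(Fintype.card n) := Real.one_le_sqrt.2 (by exact_mod_cast Fintype.card_pos)
  have hsq : √(Fintype.card n) * √(Fintype.card n) = (Fintype.card n : ℝ) :=
    Real.mul_self_sqrt (by positivity)
  have hL := h.isNearProjection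
  obtain ⟨q, x, y, hxy⟩ := hL.exists_isDominantPair (by linarith)
  obtain rfl : p = q := hxy.eq_of_apply_eq_smul hL hX hX0 (by linarith)
  have hv : ‖(√(Fintype.card n))⁻¹ • O‖ = 1 := by
    rw [norm_smul, norm_orthogonal hO, Real.norm_of_nonneg (by positivity),
      inv_mul_cancel₀ (by positivity)]
  have hve : ‖(√(Fintype.card n))⁻¹ • O - (√(Fintype.card n))⁻¹ • 1‖ ≤ 1 / 10 := by
    rw [← smul_sub, norm_smul, Real.norm_of_nonneg (by positivity)]
    exact (mul_le_of_le_one_left (norm_nonneg _) (inv_le_one_of_one_le₀ hd)).trans hO1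
  have hLv : (noisyTwirl R B ^ 4) ((√(Fintype.card n))⁻¹ • O) ∈ symmetricMatrices n := by
    rw [map_smul]
    exact Submodule.smul_mem _ _ hsym
  have hx := hxy.norm_orthogonal_proj_right_sub_le hL hη hv hve hLv
  have key := hxy.abs_inner_pow_apply_sub_pow_le hL hη (h.eigenvalue_le_one hX hX0) hx m
  have hinner : inner ℝ ((√(Fintype.card n))⁻¹ • 1)
      ((noisyTwirl R B ^ m) ((√(Fintype.card n))⁻¹ • 1)) =
        ((noisyTwirl R B ^ m) 1).trace / Fintype.card n := by
    rw [map_smul, inner_smul_left, inner_smul_right, inner_eq_trace, transpose_one,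
      Matrix.one_mul, conj_trivial, ← mul_assoc, ← mul_inv, hsq, inv_mul_eq_div]
  rw [hinner] at key
  exact key.trans_eq (by rw [show 4 = 2 * 2 from rfl, pow_mul, hη2]; ring)

/-- At `m = 1` the estimate in terms of the defect bounds the defect by a multiple of `1 - p`. -/
theorem abs_trace_pow_one_sub_pow_le [Nonempty ι] [Nonempty n]
    (h : IsNoisyDesign R B) (hδ : 8 * 10 ^ 6 * Fintype.card n * twirlDefect R B ≤ 1)
    (hO : Oᵀ * O = 1) (hO1 : ‖O - 1‖ ≤ 1 / 10)
    (hsym : (noisyTwirl R B ^ 4) O ∈ symmetricMatrices n) {p : ℝ} {X : Matrix n n ℝ}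
    (hX : noisyTwirl R B X = p • X) (hX0 : X ≠ 0) (hp : 1 / 2 ≤ p) (m : ℕ) :
    |((noisyTwirl R B ^ m) 1).trace / Fintype.card n - p ^ m| ≤
      20800 * (Fintype.card n * (1 - p)) ^ 2 := by
  have hd : (1 : ℝ) ≤ Fintype.card n := by exact_mod_cast Fintype.card_pos
  have hδ0 := h.twirlDefect_nonneg
  have hδ' : 8 * 10 ^ 6 * twirlDefect R B ≤ 1 := by nlinarith
  have key := h.abs_trace_pow_one_sub_pow_le_sq_twirlDefect hδ' hO hO1 hsym hX hX0 hp
  have hone := (abs_le.1 (key 1)).1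
  rw [pow_one, pow_one, trace_noisyTwirl_one, sub_div, div_self (by positivity)] at hone
  have hdefect : twirlDefect R B ≤ 2 * (Fintype.card n * (1 - p)) := by
    have hmul := mul_le_mul_of_nonneg_left hone (zero_le_one.trans hd)
    rw [mul_sub, mul_sub, mul_div_cancel₀ _ (by positivity : (Fintype.card n : ℝ) ≠ 0)] at hmul
    linarith [mul_le_mul_of_nonneg_right hδ hδ0]
  refine (key m).trans ?_
  nlinarith [mul_self_le_mul_self hδ0 hdefect]

end IsNoisyDesign

end Gauge

end Twirl

end FrobeniusInner

/-! ### The Liouville representation of positive maps -/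

/-- The real linear combination `∑ v_k σ_k` of the identity and the Pauli matrices. As a function
of `v` it is an isomorphism onto the hermitian matrices. -/
def pauliSum : (Fin 4 → ℝ) →ₗ[ℝ] Matrix (Fin 2) (Fin 2) ℂ := Fintype.linearCombination ℝ pauli

theorem pauliSum_apply (v : Fin 4 → ℝ) : pauliSum v = ∑ k, v k • pauli k := rfl

theorem pauliSum_single (k : Fin 4) : pauliSum (Pi.single k 1) = pauli k := by
  rw [pauliSum, Fintype.linearCombination_apply_single, one_smul]

theorem pauliSum_eq (v : Fin 4 → ℝ) : pauliSum v =
    !![(v 0 + v 3 : ℂ), v 1 - v 2 * Complex.I; v 1 + v 2 * Complex.I, v 0 - v 3] := by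
  ext i j
  fin_cases i <;> fin_cases j <;>
    simp [pauliSum_apply, pauli, Fin.sum_univ_four, smul_of] <;> ring

theorem pauli_zero : pauli 0 = 1 := one_fin_two.symm

theorem pauli_isHermitian (k : Fin 4) : (pauli k).IsHermitian := by
  ext i j
  fin_cases k <;> fin_cases i <;> fin_cases j <;> simp [pauli, conjTranspose_apply]

theorem pauliSum_isHermitian (v : Fin 4 → ℝ) : (pauliSum v).IsHermitian := by
  simp only [IsHermitian, pauliSum_apply, conjTranspose_sum, conjTranspose_smul, star_trivial,
    (pauli_isHermitian _).eq]

theorem trace_pauli_mul_pauli (j k : Fin 4) :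
    (pauli j * pauli k).trace = if j = k then 2 else 0 := by
  fin_cases j <;> fin_cases k <;> simp [pauli, trace_fin_two] <;> norm_num

theorem trace_pauli (k : Fin 4) : (pauli k).trace = if k = 0 then 2 else 0 := by
  have := trace_pauli_mul_pauli k 0
  rwa [pauli_zero, Matrix.mul_one] at this

theorem trace_pauliSum_mul_pauliSum (v w : Fin 4 → ℝ) :
    (pauliSum v * pauliSum w).trace = 2 * (v ⬝ᵥ w : ℝ) := by
  simp only [pauliSum_apply, Finset.sum_mul_sum, trace_sum, smul_mul_smul_comm, trace_smul,
    trace_pauli_mul_pauli, smul_ite, smul_zero, Finset.sum_ite_eq, Finset.mem_univ, if_true]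
  rw [← Finset.sum_smul, dotProduct, Complex.real_smul, mul_comm]

theorem ofReal_re_trace_mul {n : Type*} [Fintype n] {A B : Matrix n n ℂ} (hA : A.IsHermitian)
    (hB : B.IsHermitian) : ((A * B).trace.re : ℂ) = (A * B).trace := by
  rw [← Complex.conj_eq_iff_re, starRingEnd_apply, ← trace_conjTranspose, conjTranspose_mul, hA.eq,
    hB.eq, trace_mul_comm]

theorem sum_trace_pauli_mul_smul_pauli (A : Matrix (Fin 2) (Fin 2) ℂ) :
    ∑ k, ((pauli k * A).trace / 2) • pauli k = A := by
  ext i j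
  fin_cases i <;> fin_cases j <;>
    simp [pauli, trace_fin_two, mul_apply, Fin.sum_univ_two, Fin.sum_univ_four, smul_of] <;>
    ring_nf <;> simp <;> ring

theorem pauliSum_re_trace_pauli_mul {A : Matrix (Fin 2) (Fin 2) ℂ} (hA : A.IsHermitian) :
    pauliSum (fun k => (pauli k * A).trace.re / 2) = A := by
  rw [pauliSum_apply]
  conv_rhs => rw [← sum_trace_pauli_mul_smul_pauli A]
  refine Finset.sum_congr rfl fun k _ => ?_
  rw [← ofReal_re_trace_mul (pauli_isHermitian k) hA, ← Complex.coe_smul]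
  push_cast
  rfl

theorem superop_ext_pauli {Λ Γ : Superop 2} (h : ∀ k, Λ (pauli k) = Γ (pauli k)) : Λ = Γ := by
  refine LinearMap.ext fun A => ?_
  rw [← sum_trace_pauli_mul_smul_pauli A]
  simp only [map_sum, map_smul, h]

theorem pauliSum_cons_posSemidef {n : Fin 3 → ℝ} (hn : n ⬝ᵥ n = 1) :
    (pauliSum (Fin.cons 1 n)).PosSemidef := by
  -- `1 + n·σ` is twice a projection when `n` is a unit vector
  have hproj : pauliSum (Fin.cons 1 n) =
      (1 / 2 : ℝ) • ((pauliSum (Fin.cons 1 n))ᴴ * pauliSum (Fin.cons 1 n)) := by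
    have hnC : (n 0 * n 0 + n 1 * n 1 + n 2 * n 2 : ℂ) = 1 := by
      rw [dotProduct, Fin.sum_univ_three] at hn
      exact_mod_cast hn
    have h2 : (Fin.cons 1 n : Fin 4 → ℝ) 2 = n 1 := rfl
    have h3 : (Fin.cons 1 n : Fin 4 → ℝ) 3 = n 2 := rfl
    have hI := Complex.I_sq
    rw [(pauliSum_isHermitian _).eq, pauliSum_eq, Fin.cons_zero, Fin.cons_one, h2, h3]
    ext i j
    fin_cases i <;> fin_cases j <;> simp
    · linear_combination (-1 / 2 : ℂ) * hnC + (n 1 : ℂ) ^ 2 / 2 * hI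
    · ring
    · ring
    · linear_combination (-1 / 2 : ℂ) * hnC + (n 1 : ℂ) ^ 2 / 2 * hI
  rw [hproj]
  exact (posSemidef_conjTranspose_mul_self _).smul (by norm_num)

theorem dotProduct_self_le_of_pauliSum_cons_posSemidef {n : Fin 3 → ℝ}
    (h : (pauliSum (Fin.cons 1 n)).PosSemidef) : n ⬝ᵥ n ≤ 1 := by
  have hdet : (pauliSum (Fin.cons 1 n)).det = ((1 - n ⬝ᵥ n : ℝ) : ℂ) := by
    have h2 : (Fin.cons 1 n : Fin 4 → ℝ) 2 = n 1 := rfl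
    have h3 : (Fin.cons 1 n : Fin 4 → ℝ) 3 = n 2 := rfl
    rw [pauliSum_eq, det_fin_two_of, Fin.cons_zero, Fin.cons_one, h2, h3, dotProduct,
      Fin.sum_univ_three]
    push_cast
    linear_combination (n 1 : ℂ) ^ 2 * Complex.I_sq
  have hnonneg := h.det_nonneg
  rw [hdet, Complex.zero_le_real] at hnonneg
  linarith

/-- Positive trace preserving superoperators. Every channel is one, and those of a qubit are the
ones that map the Bloch ball into itself. -/
structure IsPosTP {d : ℕ} (Λ : Superop d) : Prop where
  pos : ∀ ρ : Matrix (Fin d) (Fin d) ℂ, ρ.PosSemidef → (Λ ρ).PosSemidef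
  tp : ∀ ρ : Matrix (Fin d) (Fin d) ℂ, (Λ ρ).trace = ρ.trace

theorem IsChannel.isPosTP {d : ℕ} {Λ : Superop d} (h : IsChannel Λ) : IsPosTP Λ where
  pos ρ hρ := (h.completelyPositive 1 (ρ.submatrix Prod.snd Prod.snd) (hρ.submatrix _)).submatrix
    fun a : Fin d => ((0 : Fin 1), a)
  tp := h.tracePreserving

theorem isPosTP_unitaryChannel {d : ℕ} (u : unitaryGroup (Fin d) ℂ) :
    IsPosTP (unitaryChannel u) where
  pos ρ hρ := hρ.mul_mul_conjTranspose_same _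
  tp ρ := by
    change ((u : Matrix (Fin d) (Fin d) ℂ) * ρ * star (u : Matrix (Fin d) (Fin d) ℂ)).trace = _
    rw [trace_mul_comm, ← Matrix.mul_assoc, Unitary.coe_star_mul_self, Matrix.one_mul]

theorem superop_expect_apply {d : ℕ} {κ : Type*} [Fintype κ] (f : κ → Superop d)
    (ρ : Matrix (Fin d) (Fin d) ℂ) : (𝔼 i, f i) ρ = 𝔼 i, f i ρ :=
  linearMap_expect ((LinearMap.applyₗ ρ).restrictScalars ℝ : Superop d →ₗ[ℝ] _) f

namespace IsPosTP

section

variable {d : ℕ} {Λ Γ : Superop d}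

theorem one : IsPosTP (1 : Superop d) := ⟨fun _ h => h, fun _ => rfl⟩

theorem mul (hΛ : IsPosTP Λ) (hΓ : IsPosTP Γ) : IsPosTP (Λ * Γ) :=
  ⟨fun ρ hρ => hΛ.pos _ (hΓ.pos ρ hρ), fun ρ => (hΛ.tp _).trans (hΓ.tp ρ)⟩

theorem expect {κ : Type*} [Fintype κ] [Nonempty κ] {f : κ → Superop d}
    (h : ∀ i, IsPosTP (f i)) : IsPosTP (𝔼 i, f i) := by
  refine ⟨fun ρ hρ => ?_, fun ρ => ?_⟩
  · rw [superop_expect_apply, Finset.expect, ← NNRat.cast_smul_eq_nnqsmul ℝ]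
    exact (posSemidef_sum _ fun i _ => (h i).pos ρ hρ).smul (NNRat.cast_nonneg _)
  · have htrace := linearMap_expect ((traceLinearMap (Fin d) ℂ ℂ).restrictScalars ℝ)
      fun i => f i ρ
    simp only [LinearMap.coe_restrictScalars, traceLinearMap_apply, (h _).tp,
      Fintype.expect_const] at htrace
    rw [superop_expect_apply, htrace]

end

variable {Λ Γ : Superop 2}

theorem isHermitian_apply_pauli (h : IsPosTP Λ) (k : Fin 4) : (Λ (pauli k)).IsHermitian := by
  have h0 : (Λ (pauli 0)).IsHermitian := by
    rw [pauli_zero]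
    exact (h.pos _ .one).isHermitian
  refine Fin.cases h0 (fun k => ?_) k
  have hcons : (Fin.cons 1 (Pi.single k 1) : Fin 4 → ℝ) = Pi.single 0 1 + Pi.single k.succ 1 := by
    ext j
    refine Fin.cases ?_ (fun j => ?_) j <;> simp [Pi.single_apply, Fin.succ_ne_zero]
  have hpos := pauliSum_cons_posSemidef (n := Pi.single k 1) (by simp)
  rw [hcons, map_add, pauliSum_single, pauliSum_single] at hpos
  simpa only [map_add, add_sub_cancel_left] using (h.pos _ hpos).isHermitian.sub h0

theorem apply_pauli (h : IsPosTP Λ) (k : Fin 4) :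
    Λ (pauli k) = pauliSum fun j => liouville Λ j k :=
  (pauliSum_re_trace_pauli_mul (h.isHermitian_apply_pauli k)).symm

theorem apply_pauliSum (h : IsPosTP Λ) (v : Fin 4 → ℝ) :
    Λ (pauliSum v) = pauliSum (liouville Λ *ᵥ v) := by
  have hcol : liouville Λ *ᵥ v = ∑ k, v k • fun j => liouville Λ j k := by
    ext j
    simp [mulVec, dotProduct, mul_comm]
  simp only [hcol, map_sum, map_smul, ← h.apply_pauli, pauliSum_apply v,
    LinearMap.map_smul_of_tower]

theorem liouville_mul (h : IsPosTP Γ) : liouville (Λ * Γ) = liouville Λ * liouville Γ := by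
  ext i k
  have hcolumn : (pauli i * (Λ * Γ) (pauli k)).trace =
      ∑ j, liouville Γ j k • (pauli i * Λ (pauli j)).trace := by
    simp only [Module.End.mul_apply, h.apply_pauli, pauliSum_apply, map_sum,
      LinearMap.map_smul_of_tower, Finset.mul_sum, trace_sum, mul_smul_comm, trace_smul]
  rw [liouville, of_apply, hcolumn, Complex.re_sum, Finset.sum_div, mul_apply]
  refine Finset.sum_congr rfl fun j _ => ?_
  rw [Complex.smul_re, smul_eq_mul, mul_div_assoc, mul_comm]
  rfl

theorem liouville_zero (h : IsPosTP Λ) (k : Fin 4) :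
    liouville Λ 0 k = if k = 0 then 1 else 0 := by
  rw [liouville, of_apply, pauli_zero, Matrix.one_mul, h.tp, trace_pauli]
  split_ifs <;> simp

theorem liouville_zero_succ (h : IsPosTP Λ) (k : Fin 3) : liouville Λ 0 k.succ = 0 := by
  rw [h.liouville_zero, if_neg k.succ_ne_zero]

theorem blochBlock_mul (h : IsPosTP Γ) :
    blochBlock (Λ * Γ) = blochBlock Λ * blochBlock Γ := by
  ext i k
  rw [blochBlock, h.liouville_mul, submatrix_apply, mul_apply, Fin.sum_univ_succ,
    h.liouville_zero_succ, mul_zero, zero_add, mul_apply]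
  rfl

end IsPosTP

/-- The translation part of the affine map `n ↦ blochShift Λ + blochBlock Λ *ᵥ n` by which a
positive trace preserving qubit map acts on Bloch vectors. -/
def blochShift (Λ : Superop 2) : Fin 3 → ℝ := fun j => liouville Λ j.succ 0

theorem IsPosTP.apply_pauliSum_cons {Λ : Superop 2} (h : IsPosTP Λ) (n : Fin 3 → ℝ) :
    Λ (pauliSum (Fin.cons 1 n)) = pauliSum (Fin.cons 1 (blochShift Λ + blochBlock Λ *ᵥ n)) := by
  rw [h.apply_pauliSum]
  congr 1
  ext j
  refine Fin.cases ?_ (fun j => ?_) j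
  · simp [mulVec, dotProduct, h.liouville_zero]
  · simp [mulVec, dotProduct, Fin.sum_univ_succ, blochShift, blochBlock]

theorem isContraction_of_dotProduct_self_eq_one {n : Type*} [Fintype n] {A : Matrix n n ℝ}
    (hA : ∀ x, x ⬝ᵥ x = 1 → (A *ᵥ x) ⬝ᵥ (A *ᵥ x) ≤ 1) : IsContraction A := by
  intro x
  obtain rfl | hx := eq_or_ne x 0
  · simp
  have hpos : 0 < x ⬝ᵥ x := by
    have hnonneg := dotProduct_self_star_nonneg x
    rw [star_trivial] at hnonneg
    exact hnonneg.lt_of_ne' fun h0 => hx (dotProduct_self_eq_zero.1 h0)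
  have hscale : (√(x ⬝ᵥ x))⁻¹ * (√(x ⬝ᵥ x))⁻¹ = (x ⬝ᵥ x)⁻¹ := by
    rw [← mul_inv, Real.mul_self_sqrt hpos.le]
  have hunit := hA ((√(x ⬝ᵥ x))⁻¹ • x)
  simp only [mulVec_smul, smul_dotProduct, dotProduct_smul, smul_eq_mul, ← mul_assoc,
    hscale] at hunit
  simpa using (inv_mul_le_iff₀ hpos).1 (hunit (inv_mul_cancel₀ hpos.ne'))

theorem IsPosTP.isContraction_blochBlock {Λ : Superop 2} (h : IsPosTP Λ) :
    IsContraction (blochBlock Λ) := by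
  refine isContraction_of_dotProduct_self_eq_one fun n hn => ?_
  have hball (m : Fin 3 → ℝ) (hm : m ⬝ᵥ m = 1) :
      (blochShift Λ + blochBlock Λ *ᵥ m) ⬝ᵥ (blochShift Λ + blochBlock Λ *ᵥ m) ≤ 1 := by
    have hpos := h.pos _ (pauliSum_cons_posSemidef hm)
    rw [h.apply_pauliSum_cons] at hpos
    exact dotProduct_self_le_of_pauliSum_cons_posSemidef hpos
  -- averaging over `n` and `-n` removes the translation
  have hplus := hball n hn
  have hminus := hball (-n) (by simpa using hn)
  have hshift := dotProduct_self_star_nonneg (blochShift Λ)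
  simp only [mulVec_neg, dotProduct_add, add_dotProduct, dotProduct_neg, neg_dotProduct,
    star_trivial] at hplus hminus hshift
  linarith

theorem blochBlock_expect {κ : Type*} [Fintype κ] (f : κ → Superop 2) :
    blochBlock (𝔼 i, f i) = 𝔼 i, blochBlock (f i) :=
  linearMap_expect
    { toFun := blochBlock
      map_add' := fun Λ Γ => by
        ext
        simp [blochBlock, liouville, Matrix.mul_add, add_div]
      map_smul' := fun c Λ => by
        ext
        simp [blochBlock, liouville, mul_div_assoc] } f

theorem unitaryChannel_mul {d : ℕ} (u v : unitaryGroup (Fin d) ℂ) :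
    unitaryChannel (u * v) = unitaryChannel u * unitaryChannel v := by
  refine LinearMap.ext fun ρ => ?_
  simp [unitaryChannel, conjTranspose_mul, Matrix.mul_assoc]

theorem unitaryChannel_one {d : ℕ} : unitaryChannel (1 : unitaryGroup (Fin d) ℂ) = 1 := by
  refine LinearMap.ext fun ρ => ?_
  simp [unitaryChannel]

theorem liouville_one : liouville 1 = 1 := by
  ext j k
  rw [liouville, of_apply, Module.End.one_apply, trace_pauli_mul_pauli, one_apply]
  split_ifs <;> simp

theorem blochBlock_one : blochBlock 1 = 1 := by
  rw [blochBlock, liouville_one, submatrix_one _ (Fin.succ_injective _)]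

section UnitaryChannel

variable (u v : unitaryGroup (Fin 2) ℂ)

theorem liouville_unitaryChannel_star :
    liouville (unitaryChannel (star u)) = (liouville (unitaryChannel u))ᵀ := by
  ext j k
  have hcycle (A B : Matrix (Fin 2) (Fin 2) ℂ) :
      (A * (star u.1 * B * u.1)).trace = (B * (u.1 * A * star u.1)).trace := by
    rw [trace_mul_comm]
    simp only [Matrix.mul_assoc]
    rw [trace_mul_comm]
    simp only [Matrix.mul_assoc]
  have hstar := hcycle (pauli j) (pauli k)
  simp only [star_eq_conjTranspose] at hstar
  simp [liouville, unitaryChannel, hstar, star_eq_conjTranspose]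

theorem blochBlock_unitaryChannel_star :
    blochBlock (unitaryChannel (star u)) = (blochBlock (unitaryChannel u))ᵀ := by
  rw [blochBlock, liouville_unitaryChannel_star]
  rfl

theorem blochBlock_unitaryChannel_mul :
    blochBlock (unitaryChannel (u * v)) =
      blochBlock (unitaryChannel u) * blochBlock (unitaryChannel v) := by
  rw [unitaryChannel_mul, (isPosTP_unitaryChannel v).blochBlock_mul]

theorem blochBlock_unitaryChannel_orthogonal :
    (blochBlock (unitaryChannel u))ᵀ * blochBlock (unitaryChannel u) = 1 := by
  rw [← blochBlock_unitaryChannel_star, ← blochBlock_unitaryChannel_mul, Unitary.star_mul_self,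
    unitaryChannel_one, blochBlock_one]

theorem blochShift_unitaryChannel : blochShift (unitaryChannel u) = 0 := by
  ext j
  have h := (isPosTP_unitaryChannel (star u)).liouville_zero_succ j
  rwa [liouville_unitaryChannel_star] at h

variable {u v}

theorem unitaryChannel_eq_of_blochBlock_eq
    (h : blochBlock (unitaryChannel u) = blochBlock (unitaryChannel v)) :
    unitaryChannel u = unitaryChannel v := by
  have hL : liouville (unitaryChannel u) = liouville (unitaryChannel v) := by
    ext j k
    refine Fin.cases ?_ (fun j => Fin.cases ?_ (fun k => ?_) k) j
    · simp only [(isPosTP_unitaryChannel _).liouville_zero]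
    · exact congrFun ((blochShift_unitaryChannel u).trans (blochShift_unitaryChannel v).symm) j
    · exact congrFun (congrFun h j) k
  refine superop_ext_pauli fun k => ?_
  simp only [(isPosTP_unitaryChannel _).apply_pauli, hL]

end UnitaryChannel

/-! ### Invariance under rotations -/

/-- The unitary `exp (i θ σ / 2) = cos (θ/2) + i sin (θ/2) σ`, where `σ` is the Pauli matrix
`σ_x`, `σ_y` or `σ_z` for `k = 0, 1, 2`; it rotates Bloch vectors about the `k`-th axis. -/
def pauliRotation (k : Fin 3) (θ : ℝ) : unitaryGroup (Fin 2) ℂ :=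
  ⟨Real.cos (θ / 2) • 1 + (Real.sin (θ / 2) * Complex.I) • pauli k.succ, by
    have hone : (Real.sin (θ / 2) : ℂ) ^ 2 + (Real.cos (θ / 2) : ℂ) ^ 2 = 1 := by
      exact_mod_cast Real.sin_sq_add_cos_sq (θ / 2)
    have hI := Complex.I_sq
    rw [mem_unitaryGroup_iff, star_eq_conjTranspose]
    ext i j
    fin_cases k <;> fin_cases i <;> fin_cases j <;>
      simp [-Complex.ofReal_cos, -Complex.ofReal_sin, pauli, mul_apply, Fin.sum_univ_two] <;>
      grind⟩

theorem blochBlock_pauliRotation (k : Fin 3) (θ : ℝ) :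
    blochBlock (unitaryChannel (pauliRotation k θ)) =
      ![!![1, 0, 0; 0, Real.cos θ, Real.sin θ; 0, -Real.sin θ, Real.cos θ],
        !![Real.cos θ, 0, -Real.sin θ; 0, 1, 0; Real.sin θ, 0, Real.cos θ],
        !![Real.cos θ, Real.sin θ, 0; -Real.sin θ, Real.cos θ, 0; 0, 0, 1]] k := by
  have hone := Real.sin_sq_add_cos_sq (θ / 2)
  have hsin : Real.sin θ = 2 * Real.sin (θ / 2) * Real.cos (θ / 2) := by
    rw [← Real.sin_two_mul]
    ring_nf
  have hcos : Real.cos θ = Real.cos (θ / 2) ^ 2 - Real.sin (θ / 2) ^ 2 := by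
    rw [← Real.cos_two_mul']
    ring_nf
  rw [hsin, hcos]
  ext i j
  fin_cases k <;> fin_cases i <;> fin_cases j <;>
    simp [-Complex.ofReal_cos, -Complex.ofReal_sin, blochBlock, liouville, unitaryChannel,
      pauliRotation, pauli, trace_fin_two, mul_apply, Fin.sum_univ_two] <;>
    grind

theorem eq_zero_of_forall_rotation_mulVec_eq {v : Fin 3 → ℝ}
    (h : ∀ u, blochBlock (unitaryChannel u) *ᵥ v = v) : v = 0 := by
  have hx := h (pauliRotation 0 Real.pi)
  have hz := h (pauliRotation 2 Real.pi)
  rw [blochBlock_pauliRotation] at hx hz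
  have h0 := congrFun hz 0
  have h1 := congrFun hz 1
  have h2 := congrFun hx 2
  simp only [mulVec, dotProduct, Fin.sum_univ_three, Real.cos_pi, Real.sin_pi, of_apply, cons_val,
    neg_zero, neg_mul, one_mul, zero_mul, add_zero, zero_add] at h0 h1 h2
  ext i
  fin_cases i <;> simp <;> linarith

theorem eq_smul_one_of_forall_rotation_conj_eq {M : Matrix (Fin 3) (Fin 3) ℝ}
    (h : ∀ u, blochBlock (unitaryChannel u) * M * (blochBlock (unitaryChannel u))ᵀ = M) :
    M = (M.trace / 3) • 1 := by
  -- half turns about two axes make `M` diagonal, quarter turns equate its diagonal entries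
  have hx := h (pauliRotation 0 Real.pi)
  have hz := h (pauliRotation 2 Real.pi)
  have hx' := h (pauliRotation 0 (Real.pi / 2))
  have hz' := h (pauliRotation 2 (Real.pi / 2))
  rw [blochBlock_pauliRotation] at hx hz hx' hz'
  have h01 := congrFun (congrFun hx 0) 1
  have h02 := congrFun (congrFun hx 0) 2
  have h10 := congrFun (congrFun hx 1) 0
  have h20 := congrFun (congrFun hx 2) 0
  have h12 := congrFun (congrFun hz 1) 2
  have h21 := congrFun (congrFun hz 2) 1
  have h11 := congrFun (congrFun hx' 1) 1
  have h00 := congrFun (congrFun hz' 0) 0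
  simp only [mul_apply, transpose_apply, Fin.sum_univ_three, of_apply, cons_val, Real.cos_pi,
    Real.sin_pi, Real.cos_pi_div_two, Real.sin_pi_div_two, neg_zero, neg_mul, mul_neg, one_mul,
    mul_one, zero_mul, mul_zero, add_zero, zero_add] at h01 h02 h10 h20 h12 h21 h11 h00
  ext i j
  fin_cases i <;> fin_cases j <;> simp [trace_fin_three] <;> linarith

theorem integrable_of_continuous {X : Type*} [TopologicalSpace X] [CompactSpace X]
    [MeasurableSpace X] [OpensMeasurableSpace X] {μ : Measure X} [IsFiniteMeasure μ]
    {E : Type*} [NormedAddCommGroup E] [SecondCountableTopology E]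
    {f : X → E} (hf : Continuous f) : Integrable f μ :=
  hf.integrable_of_hasCompactSupport (.of_compactSpace f)

section Covariant

variable {X : Type*} [MeasurableSpace X] {μ : Measure X} {T : unitaryGroup (Fin 2) ℂ → X → X}
  {a b : X → Fin 3 → ℝ}

theorem integral_eq_zero_of_covariant (hT : ∀ u, MeasurePreserving (T u) μ μ)
    (ha : ∀ u x, a (T u x) = blochBlock (unitaryChannel u) *ᵥ a x) (hint : Integrable a μ) :
    ∫ x, a x ∂μ = 0 := by
  refine eq_zero_of_forall_rotation_mulVec_eq fun u => ?_
  calc blochBlock (unitaryChannel u) *ᵥ ∫ x, a x ∂μ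
      = ∫ x, blochBlock (unitaryChannel u) *ᵥ a x ∂μ :=
        ((mulVecLin (blochBlock (unitaryChannel u))).toContinuousLinearMap.integral_comp_comm
          hint).symm
    _ = ∫ x, a (T u x) ∂μ := by simp only [ha]
    _ = ∫ x, a x ∂Measure.map (T u) μ :=
        (integral_map (hT u).measurable.aemeasurable
          ((hT u).map_eq.symm ▸ hint.aestronglyMeasurable)).symm
    _ = ∫ x, a x ∂μ := by rw [(hT u).map_eq]

theorem integral_mul_of_covariant (hT : ∀ u, MeasurePreserving (T u) μ μ)
    (ha : ∀ u x, a (T u x) = blochBlock (unitaryChannel u) *ᵥ a x)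
    (hb : ∀ u x, b (T u x) = blochBlock (unitaryChannel u) *ᵥ b x)
    (hint : ∀ j k, Integrable (fun x => a x j * b x k) μ) (j k : Fin 3) :
    ∫ x, a x j * b x k ∂μ = if j = k then (∫ x, a x ⬝ᵥ b x ∂μ) / 3 else 0 := by
  set M : Matrix (Fin 3) (Fin 3) ℝ := of fun j k => ∫ x, a x j * b x k ∂μ with hM
  have hscalar : M = (M.trace / 3) • 1 := by
    refine eq_smul_one_of_forall_rotation_conj_eq fun u => ?_
    set R := blochBlock (unitaryChannel u)
    have hexpand (i l : Fin 3) (x : X) :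
        a (T u x) i * b (T u x) l = ∑ j, ∑ k, R i j * R l k * (a x j * b x k) := by
      rw [ha, hb, mulVec, mulVec, dotProduct, dotProduct, Finset.sum_mul_sum]
      exact Finset.sum_congr rfl fun j _ => Finset.sum_congr rfl fun k _ => by ring
    ext i l
    calc (R * M * Rᵀ) i l = ∑ j, ∑ k, R i j * R l k * M j k := by
          simp only [mul_apply, transpose_apply, Finset.sum_mul]
          rw [Finset.sum_comm]
          exact Finset.sum_congr rfl fun j _ => Finset.sum_congr rfl fun k _ => by ring
      _ = ∫ x, a (T u x) i * b (T u x) l ∂μ := by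
          simp only [hexpand]
          rw [integral_finsetSum _ fun j _ => integrable_finsetSum _ fun k _ =>
            (hint j k).const_mul _]
          refine Finset.sum_congr rfl fun j _ => ?_
          rw [integral_finsetSum _ fun k _ => (hint j k).const_mul _]
          exact Finset.sum_congr rfl fun k _ => (integral_const_mul _ _).symm
      _ = ∫ x, a x i * b x l ∂Measure.map (T u) μ :=
          (integral_map (hT u).measurable.aemeasurable
            ((hT u).map_eq.symm ▸ (hint i l).aestronglyMeasurable)).symm
      _ = M i l := by rw [(hT u).map_eq, hM, of_apply]
  have htrace : M.trace = ∫ x, a x ⬝ᵥ b x ∂μ := by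
    simp only [dotProduct]
    rw [integral_finsetSum _ fun j _ => hint j j]
    rfl
  calc ∫ x, a x j * b x k ∂μ = M j k := rfl
    _ = _ := by
      rw [hscalar, htrace, Matrix.smul_apply, one_apply, smul_eq_mul, mul_ite, mul_one, mul_zero]

end Covariant

/-! ### The average fidelity of qubit maps -/

section Sphere

variable {E : Type*} [NormedAddCommGroup E] [InnerProductSpace ℝ E] [FiniteDimensional ℝ E]

/-- The action of a linear isometry on the unit sphere. -/
def sphereMap (f : E ≃ₗᵢ[ℝ] E) : Metric.sphere (0 : E) 1 ≃ₜ Metric.sphere (0 : E) 1 where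
  toFun x := ⟨f x, by simp⟩
  invFun x := ⟨f.symm x, by simp⟩
  left_inv x := by simp
  right_inv x := by simp
  continuous_toFun := by fun_prop
  continuous_invFun := by fun_prop

open scoped Pointwise in
theorem measurePreserving_sphereMap [MeasurableSpace E] [BorelSpace E] (f : E ≃ₗᵢ[ℝ] E) :
    MeasurePreserving (sphereMap f) (volume : Measure E).toSphere
      (volume : Measure E).toSphere := by
  refine ⟨(sphereMap f).measurable, Measure.ext fun s hs => ?_⟩
  have hcone : (Set.Ioo (0 : ℝ) 1 • ((↑) '' (sphereMap f ⁻¹' s) : Set E)) =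
      f ⁻¹' (Set.Ioo (0 : ℝ) 1 • ((↑) '' s : Set E)) := by
    ext x
    simp only [Set.mem_smul, Set.mem_preimage, Set.mem_image]
    constructor
    · rintro ⟨r, hr, _, ⟨y, hy, rfl⟩, rfl⟩
      exact ⟨r, hr, _, ⟨_, hy, rfl⟩, by simp [sphereMap]⟩
    · rintro ⟨r, hr, _, ⟨y, hy, rfl⟩, hx⟩
      refine ⟨r, hr, _, ⟨(sphereMap f).symm y, by simpa using hy, rfl⟩, f.injective ?_⟩
      rw [← hx, map_smul]
      simp [sphereMap]
  rw [Measure.map_apply (sphereMap f).measurable hs, Measure.toSphere_apply' _ hs,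
    Measure.toSphere_apply' _ ((sphereMap f).measurable hs), hcone]
  congr 1
  exact f.measurePreserving.measure_preimage_emb f.toHomeomorph.measurableEmbedding _

end Sphere

section PureState

variable {d : ℕ}

/-- A unitary matrix as a real linear isometry of the Hilbert space `ℂ^d`. -/
def unitaryIsometry (u : unitaryGroup (Fin d) ℂ) :
    EuclideanSpace ℂ (Fin d) ≃ₗᵢ[ℝ] EuclideanSpace ℂ (Fin d) :=
  let f := Unitary.linearIsometryEquiv
    (⟨toEuclideanCLM (𝕜 := ℂ) u.1, Unitary.map_mem _ u.2⟩ :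
      unitary (EuclideanSpace ℂ (Fin d) →L[ℂ] EuclideanSpace ℂ (Fin d)))
  { f.toLinearEquiv.restrictScalars ℝ with norm_map' := f.norm_map }

theorem unitaryIsometry_apply (u : unitaryGroup (Fin d) ℂ) (ψ : EuclideanSpace ℂ (Fin d))
    (i : Fin d) : unitaryIsometry u ψ i = (u.1 *ᵥ fun j => ψ j) i := rfl

theorem pureState_unitaryIsometry (u : unitaryGroup (Fin d) ℂ) (ψ : EuclideanSpace ℂ (Fin d)) :
    pureState (unitaryIsometry u ψ) = unitaryChannel u (pureState ψ) := by
  change _ = u.1 * vecMulVec _ _ * u.1ᴴ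
  rw [mul_vecMulVec, vecMulVec_mul]
  ext i j
  simp [pureState, vecMulVec_apply, unitaryIsometry_apply, mulVec, vecMul, dotProduct, mul_comm]

theorem pureState_isHermitian (ψ : EuclideanSpace ℂ (Fin d)) : (pureState ψ).IsHermitian := by
  ext i j
  simp [pureState, vecMulVec_apply, mul_comm]

theorem trace_pureState {ψ : EuclideanSpace ℂ (Fin d)} (hψ : ‖ψ‖ = 1) :
    (pureState ψ).trace = 1 := by
  have hsum := EuclideanSpace.norm_sq_eq ψ
  rw [hψ, one_pow] at hsum
  simp only [pureState, Matrix.trace, diag_apply, vecMulVec_apply, RCLike.star_def,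
    Complex.mul_conj, Complex.normSq_eq_norm_sq]
  exact_mod_cast hsum.symm

theorem continuous_pureState : Continuous (pureState (d := d)) := by
  unfold pureState
  fun_prop

theorem pureState_mul_self {ψ : EuclideanSpace ℂ (Fin d)} (hψ : ‖ψ‖ = 1) :
    pureState ψ * pureState ψ = pureState ψ := by
  have htrace := trace_pureState hψ
  rw [pureState, trace_vecMulVec, dotProduct_comm] at htrace
  rw [pureState, vecMulVec_mul_vecMulVec, htrace, one_smul]

end PureState

/-- The Bloch vector of the pure state on `ψ`. -/
def blochVector (ψ : EuclideanSpace ℂ (Fin 2)) (j : Fin 3) : ℝ :=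
  (pauli j.succ * pureState ψ).trace.re

theorem pureState_eq_pauliSum {ψ : EuclideanSpace ℂ (Fin 2)} (hψ : ‖ψ‖ = 1) :
    pureState ψ = pauliSum ((1 / 2 : ℝ) • Fin.cons 1 (blochVector ψ)) := by
  rw [← pauliSum_re_trace_pauli_mul (pureState_isHermitian ψ)]
  congr 1
  ext k
  cases k using Fin.cases with
  | zero => simp [pauli_zero, trace_pureState hψ]
  | succ k => simp [blochVector, div_eq_inv_mul]

theorem blochVector_dotProduct_self {ψ : EuclideanSpace ℂ (Fin 2)} (hψ : ‖ψ‖ = 1) :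
    blochVector ψ ⬝ᵥ blochVector ψ = 1 := by
  have htrace : (pureState ψ * pureState ψ).trace = 1 := by
    rw [pureState_mul_self hψ, trace_pureState hψ]
  rw [pureState_eq_pauliSum hψ, trace_pauliSum_mul_pauliSum, smul_dotProduct, dotProduct_smul,
    dotProduct, Fin.sum_univ_succ] at htrace
  simp only [Fin.cons_zero, Fin.cons_succ, smul_eq_mul] at htrace
  norm_cast at htrace
  rw [dotProduct]
  linarith

theorem IsPosTP.apply_pureState {Λ : Superop 2} (h : IsPosTP Λ) {ψ : EuclideanSpace ℂ (Fin 2)}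
    (hψ : ‖ψ‖ = 1) :
    Λ (pureState ψ) =
      pauliSum ((1 / 2 : ℝ) • Fin.cons 1 (blochShift Λ + blochBlock Λ *ᵥ blochVector ψ)) := by
  rw [pureState_eq_pauliSum hψ, map_smul pauliSum, LinearMap.map_smul_of_tower, map_smul pauliSum,
    h.apply_pauliSum_cons]

theorem blochVector_unitaryIsometry (u : unitaryGroup (Fin 2) ℂ) {ψ : EuclideanSpace ℂ (Fin 2)}
    (hψ : ‖ψ‖ = 1) :
    blochVector (unitaryIsometry u ψ) = blochBlock (unitaryChannel u) *ᵥ blochVector ψ := by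
  ext j
  rw [blochVector, pureState_unitaryIsometry, (isPosTP_unitaryChannel u).apply_pureState hψ,
    blochShift_unitaryChannel, zero_add, ← pauliSum_single, trace_pauliSum_mul_pauliSum]
  simp

theorem continuous_blochVector : Continuous blochVector := by
  refine continuous_pi fun j => Complex.continuous_re.comp ?_
  exact (continuous_const.matrix_mul continuous_pureState).matrix_trace

/-- The uniform probability measure on pure states, realised on the unit sphere of `ℂ²`. -/
def uniformState : Measure (Metric.sphere (0 : EuclideanSpace ℂ (Fin 2)) 1) :=
  ((volume : Measure (EuclideanSpace ℂ (Fin 2))).toSphere Set.univ)⁻¹ •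
    (volume : Measure (EuclideanSpace ℂ (Fin 2))).toSphere

instance : IsProbabilityMeasure uniformState := by
  have : NeZero (volume : Measure (EuclideanSpace ℂ (Fin 2))).toSphere :=
    ⟨Measure.toSphere_ne_zero _⟩
  unfold uniformState
  infer_instance

theorem measurePreserving_uniformState (u : unitaryGroup (Fin 2) ℂ) :
    MeasurePreserving (sphereMap (unitaryIsometry u)) uniformState uniformState :=
  (measurePreserving_sphereMap _).smul_measure _

theorem integral_dotProduct_blochVector (w : Fin 3 → ℝ) :
    ∫ ψ, w ⬝ᵥ blochVector ψ.1 ∂uniformState = 0 := by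
  have hint : Integrable (fun ψ => blochVector ψ.1) uniformState :=
    integrable_of_continuous (continuous_blochVector.comp continuous_subtype_val)
  calc ∫ ψ, w ⬝ᵥ blochVector ψ.1 ∂uniformState
      = w ⬝ᵥ ∫ ψ, blochVector ψ.1 ∂uniformState :=
        (dotProductBilin ℝ ℝ w).toContinuousLinearMap.integral_comp_comm hint
    _ = 0 := by
        rw [integral_eq_zero_of_covariant measurePreserving_uniformState
          (fun u ψ => blochVector_unitaryIsometry u (by simp)) hint, dotProduct_zero]

theorem integral_blochVector_dotProduct_mulVec (M : Matrix (Fin 3) (Fin 3) ℝ) :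
    ∫ ψ, blochVector ψ.1 ⬝ᵥ (M *ᵥ blochVector ψ.1) ∂uniformState = M.trace / 3 := by
  have hint (j k : Fin 3) :
      Integrable (fun ψ => blochVector ψ.1 j * blochVector ψ.1 k) uniformState := by
    have := continuous_blochVector
    exact integrable_of_continuous (by fun_prop)
  have hmoment (j k : Fin 3) :
      ∫ ψ, blochVector ψ.1 j * blochVector ψ.1 k ∂uniformState = if j = k then 1 / 3 else 0 := by
    have hcov u (ψ : Metric.sphere (0 : EuclideanSpace ℂ (Fin 2)) 1) :=
      blochVector_unitaryIsometry u (ψ := ψ.1) (by simp)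
    rw [integral_mul_of_covariant measurePreserving_uniformState hcov hcov hint]
    simp [blochVector_dotProduct_self]
  calc ∫ ψ, blochVector ψ.1 ⬝ᵥ (M *ᵥ blochVector ψ.1) ∂uniformState
      = ∫ ψ, ∑ j, ∑ k, M j k * (blochVector ψ.1 j * blochVector ψ.1 k) ∂uniformState := by
        simp only [dotProduct, mulVec, Finset.mul_sum, mul_left_comm]
    _ = ∑ j, ∑ k, M j k * ∫ ψ, blochVector ψ.1 j * blochVector ψ.1 k ∂uniformState := by
        rw [integral_finsetSum _ fun j _ => integrable_finsetSum _ fun k _ =>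
          (hint j k).const_mul (M j k)]
        refine Finset.sum_congr rfl fun j _ => ?_
        rw [integral_finsetSum _ fun k _ => (hint j k).const_mul (M j k)]
        exact Finset.sum_congr rfl fun k _ => integral_const_mul _ _
    _ = M.trace / 3 := by
        simp [hmoment, Matrix.trace, Finset.sum_mul, div_eq_mul_inv]

theorem re_trace_apply_pureState {Λ Γ : Superop 2} (hΛ : IsPosTP Λ) (hΓ : IsPosTP Γ)
    {ψ : EuclideanSpace ℂ (Fin 2)} (hψ : ‖ψ‖ = 1) :
    ((Λ (pureState ψ))ᴴ * Γ (pureState ψ)).trace.re = 1 / 2 +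
      1 / 2 * ((blochShift Λ + blochBlock Λ *ᵥ blochVector ψ) ⬝ᵥ
        (blochShift Γ + blochBlock Γ *ᵥ blochVector ψ)) := by
  rw [hΛ.apply_pureState hψ, hΓ.apply_pureState hψ, (pauliSum_isHermitian _).eq,
    trace_pauliSum_mul_pauliSum, smul_dotProduct, dotProduct_smul, dotProduct, Fin.sum_univ_succ,
    dotProduct]
  simp only [Fin.cons_zero, Fin.cons_succ, smul_eq_mul]
  norm_cast
  ring

theorem avgFidelity_eq {Λ Γ : Superop 2} (hΛ : IsPosTP Λ) (hΓ : IsPosTP Γ)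
    (hΓ0 : blochShift Γ = 0) :
    avgFidelity Λ Γ = 1 / 2 + 1 / 6 * ((blochBlock Γ)ᵀ * blochBlock Λ).trace := by
  set w := (blochBlock Γ)ᵀ *ᵥ blochShift Λ
  set M := (blochBlock Γ)ᵀ * blochBlock Λ
  have hcont : Continuous fun ψ : Metric.sphere (0 : EuclideanSpace ℂ (Fin 2)) 1 =>
      blochVector ψ.1 := continuous_blochVector.comp continuous_subtype_val
  calc avgFidelity Λ Γ = ∫ ψ, (((Λ (pureState ψ.1))ᴴ * Γ (pureState ψ.1)).trace).re
        ∂uniformState := rfl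
    _ = ∫ ψ, (1 / 2 + 1 / 2 * (w ⬝ᵥ blochVector ψ.1 +
          blochVector ψ.1 ⬝ᵥ (M *ᵥ blochVector ψ.1))) ∂uniformState := by
        refine integral_congr_ae (ae_of_all _ fun ψ => ?_)
        simp only
        rw [re_trace_apply_pureState hΛ hΓ (by simp), hΓ0, zero_add, add_dotProduct,
          ← mulVec_mulVec, dotProduct_transpose_mulVec, dotProduct_comm w,
          dotProduct_transpose_mulVec]
    _ = 1 / 2 + 1 / 2 * (0 + M.trace / 3) := by
        rw [integral_add, integral_const_mul, integral_add,
          integral_dotProduct_blochVector, integral_blochVector_dotProduct_mulVec]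
        · simp
        all_goals exact integrable_of_continuous (by fun_prop)
    _ = _ := by ring

/-! ### Moments of a unitary 2-design -/

instance {d : ℕ} : CompactSpace (unitaryGroup (Fin d) ℂ) := by
  have hbox : IsCompact (Set.univ.pi fun _ : Fin d => Set.univ.pi fun _ : Fin d =>
      Metric.closedBall (0 : ℂ) 1) :=
    isCompact_univ_pi fun _ => isCompact_univ_pi fun _ => isCompact_closedBall 0 1
  have hclosed : IsClosed {A : Matrix (Fin d) (Fin d) ℂ | A ∈ unitaryGroup (Fin d) ℂ} := by
    simp only [mem_unitaryGroup_iff]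
    exact isClosed_eq (continuous_id.matrix_mul continuous_id.matrix_conjTranspose)
      continuous_const
  exact isCompact_iff_compactSpace.1 <| hbox.of_isClosed_subset hclosed fun A hA i _ j _ =>
    mem_closedBall_zero_iff.2 (entry_norm_bound_of_unitary hA i j)

theorem continuous_liouville_unitaryChannel (j k : Fin 4) :
    Continuous fun v : unitaryGroup (Fin 2) ℂ => liouville (unitaryChannel v) j k := by
  have hcoe : Continuous fun v : unitaryGroup (Fin 2) ℂ => v.1 := continuous_subtype_val
  have hmul : Continuous fun v : unitaryGroup (Fin 2) ℂ =>
      (pauli j * (v.1 * pauli k * v.1ᴴ)).trace :=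
    (continuous_const.matrix_mul
      ((hcoe.matrix_mul continuous_const).matrix_mul hcoe.matrix_conjTranspose)).matrix_trace
  exact (Complex.continuous_re.comp hmul).div_const 2

theorem continuous_blochBlock_unitaryChannel :
    Continuous fun v : unitaryGroup (Fin 2) ℂ => blochBlock (unitaryChannel v) :=
  continuous_matrix fun j k => continuous_liouville_unitaryChannel j.succ k.succ

theorem IsPosTP.liouville_ofReal {Λ : Superop 2} (h : IsPosTP Λ) (j k : Fin 4) :
    (liouville Λ j k : ℂ) = (pauli j * Λ (pauli k)).trace / 2 := by
  rw [← ofReal_re_trace_mul (pauli_isHermitian j) (h.isHermitian_apply_pauli k)]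
  simp [liouville]

theorem liouville_mul_liouville_unitaryChannel (v : unitaryGroup (Fin 2) ℂ) (j k j' k' : Fin 4) :
    ((liouville (unitaryChannel v) j k * liouville (unitaryChannel v) j' k' : ℝ) : ℂ) =
      ∑ x, ∑ y, ((pauli j ⊗ₖ pauli j') x y / 4) *
        ((v.1 ⊗ₖ v.1) * (pauli k ⊗ₖ pauli k') * (v.1 ⊗ₖ v.1)ᴴ) y x := by
  have htensor : (v.1 ⊗ₖ v.1) * (pauli k ⊗ₖ pauli k') * (v.1 ⊗ₖ v.1)ᴴ =
      unitaryChannel v (pauli k) ⊗ₖ unitaryChannel v (pauli k') := by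
    rw [conjTranspose_kronecker, ← mul_kronecker_mul, ← mul_kronecker_mul]
    rfl
  calc ((liouville (unitaryChannel v) j k * liouville (unitaryChannel v) j' k' : ℝ) : ℂ)
      = ((pauli j ⊗ₖ pauli j') *
          (unitaryChannel v (pauli k) ⊗ₖ unitaryChannel v (pauli k'))).trace / 4 := by
        rw [← mul_kronecker_mul, trace_kronecker, Complex.ofReal_mul,
          (isPosTP_unitaryChannel v).liouville_ofReal, (isPosTP_unitaryChannel v).liouville_ofReal]
        ring
    _ = _ := by
        rw [htensor]
        simp only [trace, diag_apply, mul_apply, Finset.sum_div, div_mul_eq_mul_div]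

section Haar

variable [MeasurableSpace (unitaryGroup (Fin 2) ℂ)] [BorelSpace (unitaryGroup (Fin 2) ℂ)]
  {μ : Measure (unitaryGroup (Fin 2) ℂ)} [IsProbabilityMeasure μ]

theorem integral_blochBlock_unitaryChannel
    (hμ : ∀ g : unitaryGroup (Fin 2) ℂ, MeasurePreserving (g * ·) μ μ) (j k : Fin 3) :
    ∫ v, blochBlock (unitaryChannel v) j k ∂μ = 0 := by
  have hcont : Continuous fun v : unitaryGroup (Fin 2) ℂ => (blochBlock (unitaryChannel v)).col k :=
    continuous_pi fun j => continuous_blochBlock_unitaryChannel.matrix_elem j k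
  have hzero := integral_eq_zero_of_covariant hμ
    (fun u v => by rw [blochBlock_unitaryChannel_mul]; rfl) (integrable_of_continuous hcont)
  exact (eval_integral (fun j => integrable_of_continuous <|
    (continuous_apply j).comp hcont) j).symm.trans (congrFun hzero j)

theorem integral_blochBlock_mul_blochBlock_unitaryChannel
    (hμ : ∀ g : unitaryGroup (Fin 2) ℂ, MeasurePreserving (g * ·) μ μ) (j k j' k' : Fin 3) :
    ∫ v, blochBlock (unitaryChannel v) j k * blochBlock (unitaryChannel v) j' k' ∂μ =
      if j = j' ∧ k = k' then 1 / 3 else 0 := by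
  have hcov (k : Fin 3) (u v : unitaryGroup (Fin 2) ℂ) :
      (blochBlock (unitaryChannel (u * v))).col k =
        blochBlock (unitaryChannel u) *ᵥ (blochBlock (unitaryChannel v)).col k := by
    rw [blochBlock_unitaryChannel_mul]
    rfl
  have horth (v : unitaryGroup (Fin 2) ℂ) :
      (blochBlock (unitaryChannel v)).col k ⬝ᵥ (blochBlock (unitaryChannel v)).col k' =
        (1 : Matrix (Fin 3) (Fin 3) ℝ) k k' := by
    rw [← blochBlock_unitaryChannel_orthogonal v]
    rfl
  calc _ = if j = j' then (∫ v, (blochBlock (unitaryChannel v)).col k ⬝ᵥ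
            (blochBlock (unitaryChannel v)).col k' ∂μ) / 3 else 0 :=
        integral_mul_of_covariant hμ (hcov k) (hcov k') (fun a b => integrable_of_continuous <|
          (continuous_blochBlock_unitaryChannel.matrix_elem a k).mul
            (continuous_blochBlock_unitaryChannel.matrix_elem b k')) j j'
    _ = _ := by
        simp only [horth, integral_const, probReal_univ, one_smul, one_apply]
        split_ifs <;> simp_all

end Haar

section TwoDesign

variable {ι : Type*} [Fintype ι] {U : ι → unitaryGroup (Fin 2) ℂ}

theorem expect_matrix_apply {m n : Type*} (f : ι → Matrix m n ℝ) (a : m) (b : n) :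
    (𝔼 i, f i) a b = 𝔼 i, f i a b :=
  linearMap_expect (entryLinearMap ℝ ℝ a b) f

theorem expect_liouville_mul_liouville [MeasurableSpace (unitaryGroup (Fin 2) ℂ)]
    [BorelSpace (unitaryGroup (Fin 2) ℂ)]
    {μ : Measure (unitaryGroup (Fin 2) ℂ)} [IsProbabilityMeasure μ]
    (h : ∀ (A : Matrix (Fin 2 × Fin 2) (Fin 2 × Fin 2) ℂ) (x y : Fin 2 × Fin 2),
      (𝔼 i, (((U i).1 ⊗ₖ (U i).1) * A * ((U i).1 ⊗ₖ (U i).1)ᴴ) x y) =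
        ∫ v : unitaryGroup (Fin 2) ℂ, ((v.1 ⊗ₖ v.1) * A * (v.1 ⊗ₖ v.1)ᴴ) x y ∂μ)
    (j k j' k' : Fin 4) :
    𝔼 i, liouville (unitaryChannel (U i)) j k * liouville (unitaryChannel (U i)) j' k' =
      ∫ v, liouville (unitaryChannel v) j k * liouville (unitaryChannel v) j' k' ∂μ := by
  have hcont (x y) : Continuous fun v : unitaryGroup (Fin 2) ℂ =>
      ((v.1 ⊗ₖ v.1) * (pauli k ⊗ₖ pauli k') * (v.1 ⊗ₖ v.1)ᴴ) x y := by
    have hkron : Continuous fun v : unitaryGroup (Fin 2) ℂ => v.1 ⊗ₖ v.1 :=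
      continuous_matrix fun a b => (continuous_subtype_val.matrix_elem _ _).mul
        (continuous_subtype_val.matrix_elem _ _)
    exact ((hkron.matrix_mul continuous_const).matrix_mul
      hkron.matrix_conjTranspose).matrix_elem x y
  have hint (c : ℂ) (x y) : Integrable (fun v : unitaryGroup (Fin 2) ℂ =>
      c * ((v.1 ⊗ₖ v.1) * (pauli k ⊗ₖ pauli k') * (v.1 ⊗ₖ v.1)ᴴ) x y) μ :=
    (integrable_of_continuous (hcont x y)).const_mul c
  apply Complex.ofReal_injective
  rw [← integral_complex_ofReal, Complex.ofReal_expect]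
  simp only [liouville_mul_liouville_unitaryChannel]
  rw [integral_finsetSum _ fun x _ => integrable_finsetSum _ fun y _ => hint _ y x,
    Finset.expect_sum_comm]
  refine Finset.sum_congr rfl fun x _ => ?_
  rw [integral_finsetSum _ fun y _ => hint _ y x, Finset.expect_sum_comm]
  refine Finset.sum_congr rfl fun y _ => ?_
  rw [integral_const_mul, ← h, Finset.mul_expect]

namespace IsUnitaryTwoDesign

theorem expect_blochBlock (hU : IsUnitaryTwoDesign U) :
    𝔼 i, blochBlock (unitaryChannel (U i)) = 0 := by
  obtain ⟨μ, hprob, hinv, h⟩ := hU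
  let _ : MeasurableSpace (unitaryGroup (Fin 2) ℂ) := borel _
  have : BorelSpace (unitaryGroup (Fin 2) ℂ) := ⟨rfl⟩
  have hμ (g : unitaryGroup (Fin 2) ℂ) : MeasurePreserving (g * ·) μ μ :=
    ⟨(continuous_const_mul g).measurable, hinv g⟩
  ext j k
  have hmoment := expect_liouville_mul_liouville h j.succ k.succ 0 0
  simp only [(isPosTP_unitaryChannel _).liouville_zero, if_true, mul_one] at hmoment
  rw [expect_matrix_apply]
  exact hmoment.trans (integral_blochBlock_unitaryChannel hμ j k)

theorem expect_blochBlock_mul (hU : IsUnitaryTwoDesign U) (j k j' k' : Fin 3) :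
    𝔼 i, blochBlock (unitaryChannel (U i)) j k * blochBlock (unitaryChannel (U i)) j' k' =
      if j = j' ∧ k = k' then 1 / 3 else 0 := by
  obtain ⟨μ, hprob, hinv, h⟩ := hU
  let _ : MeasurableSpace (unitaryGroup (Fin 2) ℂ) := borel _
  have : BorelSpace (unitaryGroup (Fin 2) ℂ) := ⟨rfl⟩
  have hμ (g : unitaryGroup (Fin 2) ℂ) : MeasurePreserving (g * ·) μ μ :=
    ⟨(continuous_const_mul g).measurable, hinv g⟩
  exact (expect_liouville_mul_liouville h j.succ k.succ j'.succ k'.succ).trans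
    (integral_blochBlock_mul_blochBlock_unitaryChannel hμ j k j' k')

theorem expect_transpose_mul_mul (hU : IsUnitaryTwoDesign U) (X : Matrix (Fin 3) (Fin 3) ℝ) :
    𝔼 i, (blochBlock (unitaryChannel (U i)))ᵀ * X * blochBlock (unitaryChannel (U i)) =
      (X.trace / 3) • 1 := by
  ext a b
  have hexpand (B : Matrix (Fin 3) (Fin 3) ℝ) :
      (Bᵀ * X * B) a b = ∑ j, ∑ j', X j' j * (B j' a * B j b) := by
    simp only [mul_apply, Finset.sum_mul, transpose_apply]
    exact Finset.sum_congr rfl fun j _ => Finset.sum_congr rfl fun j' _ => by ring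
  simp only [expect_matrix_apply, hexpand, Finset.expect_sum_comm, ← Finset.mul_expect,
    hU.expect_blochBlock_mul]
  by_cases hab : a = b <;> simp [hab, Matrix.trace, Finset.sum_mul, div_eq_mul_inv]

end IsUnitaryTwoDesign

end TwoDesign

/-! ### Optimal corrections -/

theorem avgFidelity_mul_unitaryChannel_one {Λ : Superop 2} (h : IsPosTP Λ)
    (V : unitaryGroup (Fin 2) ℂ) : avgFidelity (Λ * unitaryChannel V) 1 =
      1 / 2 + 1 / 6 * (blochBlock Λ * blochBlock (unitaryChannel V)).trace := by
  have hshift : blochShift 1 = 0 := by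
    rw [← unitaryChannel_one, blochShift_unitaryChannel]
  rw [avgFidelity_eq (h.mul (isPosTP_unitaryChannel V)) IsPosTP.one hshift, blochBlock_one,
    transpose_one, Matrix.one_mul, (isPosTP_unitaryChannel V).blochBlock_mul]

theorem avgFidelity_one {Λ : Superop 2} (h : IsPosTP Λ) :
    avgFidelity Λ 1 = 1 / 2 + 1 / 6 * (blochBlock Λ).trace := by
  simpa [unitaryChannel_one, blochBlock_one] using avgFidelity_mul_unitaryChannel_one h 1

theorem isOptimalCorrection_iff {Λ : Superop 2} (h : IsPosTP Λ) {W : unitaryGroup (Fin 2) ℂ} :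
    IsOptimalCorrection Λ W ↔ ∀ V, (blochBlock Λ * blochBlock (unitaryChannel V)).trace ≤
      (blochBlock Λ * blochBlock (unitaryChannel W)).trace := by
  refine forall_congr' fun V => ?_
  rw [avgFidelity_mul_unitaryChannel_one h, avgFidelity_mul_unitaryChannel_one h]
  constructor <;> intro h <;> linarith

theorem exists_isOptimalCorrection {Λ : Superop 2} (h : IsPosTP Λ) :
    ∃ W, IsOptimalCorrection Λ W := by
  have hcont : Continuous fun V : unitaryGroup (Fin 2) ℂ =>
      (blochBlock Λ * blochBlock (unitaryChannel V)).trace :=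
    (continuous_const.matrix_mul continuous_blochBlock_unitaryChannel).matrix_trace
  obtain ⟨W, -, hW⟩ := isCompact_univ.exists_isMaxOn Set.univ_nonempty hcont.continuousOn
  exact ⟨W, (isOptimalCorrection_iff h).2 fun V => hW (Set.mem_univ V)⟩

theorem eq_zero_of_forall_mul_cos_add_mul_sin_le {a b : ℝ}
    (h : ∀ θ, a * Real.cos θ + b * Real.sin θ ≤ a) : b = 0 := by
  have hderiv : HasDerivAt (fun θ => a * Real.cos θ + b * Real.sin θ) b 0 := by
    simpa using ((Real.hasDerivAt_cos 0).const_mul a).fun_add ((Real.hasDerivAt_sin 0).const_mul b)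
  have hmax : IsLocalMax (fun θ => a * Real.cos θ + b * Real.sin θ) 0 :=
    .of_forall fun θ => by simpa using h θ
  exact hmax.hasDerivAt_eq_zero hderiv

theorem transpose_eq_of_trace_mul_rotation_le {D : Matrix (Fin 3) (Fin 3) ℝ}
    (h : ∀ V, (D * blochBlock (unitaryChannel V)).trace ≤ D.trace) : Dᵀ = D := by
  have hx : D 2 1 - D 1 2 = 0 := by
    refine eq_zero_of_forall_mul_cos_add_mul_sin_le (a := D 1 1 + D 2 2) fun θ => ?_
    have hθ := h (pauliRotation 0 θ)
    simp only [blochBlock_pauliRotation, trace_fin_three, mul_apply, Fin.sum_univ_three, of_apply,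
      cons_val] at hθ
    linarith
  have hy : D 0 2 - D 2 0 = 0 := by
    refine eq_zero_of_forall_mul_cos_add_mul_sin_le (a := D 0 0 + D 2 2) fun θ => ?_
    have hθ := h (pauliRotation 1 θ)
    simp only [blochBlock_pauliRotation, trace_fin_three, mul_apply, Fin.sum_univ_three, of_apply,
      cons_val] at hθ
    linarith
  have hz : D 1 0 - D 0 1 = 0 := by
    refine eq_zero_of_forall_mul_cos_add_mul_sin_le (a := D 0 0 + D 1 1) fun θ => ?_
    have hθ := h (pauliRotation 2 θ)
    simp only [blochBlock_pauliRotation, trace_fin_three, mul_apply, Fin.sum_univ_three, of_apply,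
      cons_val] at hθ
    linarith
  ext i j
  fin_cases i <;> fin_cases j <;> simp <;> linarith

section Polar

variable {n : Type*} [Fintype n] [DecidableEq n]

attribute [local instance] frobeniusNormedAddCommGroup frobeniusNormedSpace frobeniusInner

theorem posDef_of_norm_sub_one_lt {D : Matrix n n ℝ} (hD : Dᵀ = D) (h : ‖D - 1‖ < 1) :
    D.PosDef := by
  refine .of_dotProduct_mulVec_pos ?_ fun x hx => ?_
  · rw [IsHermitian, conjTranspose_eq_transpose_of_trivial, hD]
  have hpos : 0 < x ⬝ᵥ x := by
    simpa using dotProduct_star_self_pos_iff.2 hx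
  have hnorm : ‖vecMulVec x x‖ = x ⬝ᵥ x := by
    rw [← sq_eq_sq₀ (norm_nonneg _) hpos.le, ← trace_transpose_mul_self, transpose_vecMulVec,
      vecMulVec_mul_vecMulVec, trace_vecMulVec, dotProduct_smul, smul_eq_mul, sq]
  have hinner : inner ℝ (vecMulVec x x) (D - 1) = x ⬝ᵥ (D *ᵥ x) - x ⬝ᵥ x := by
    rw [inner_eq_trace, transpose_vecMulVec, vecMulVec_mul, trace_vecMulVec, vecMul_sub,
      dotProduct_sub, vecMul_one, dotProduct_comm x (x ᵥ* D), ← dotProduct_mulVec]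
  have hle := (abs_le.1 (abs_real_inner_le_norm (vecMulVec x x) (D - 1))).1
  rw [hinner, hnorm] at hle
  rw [star_trivial]
  nlinarith

variable {Q : Matrix n n ℝ}

theorem norm_mul_orthogonal (hQ : Qᵀ * Q = 1) (X : Matrix n n ℝ) : ‖X * Q‖ = ‖X‖ := by
  have hQ' : Qᵀᵀ * Qᵀ = 1 := by rw [transpose_transpose, mul_eq_one_comm.1 hQ]
  rw [← frobenius_norm_transpose, transpose_mul, norm_orthogonal_mul hQ', frobenius_norm_transpose]

theorem norm_mul_one_sub_sq (hQ : Qᵀ * Q = 1) (B : Matrix n n ℝ) :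
    ‖B * (1 - Q)‖ ^ 2 = 2 * (Bᵀ * B).trace - 2 * (Bᵀ * B * Q).trace := by
  rw [Matrix.mul_sub, Matrix.mul_one, @norm_sub_sq_real, norm_mul_orthogonal hQ,
    ← trace_transpose_mul_self, inner_eq_trace, ← Matrix.mul_assoc]
  ring

theorem trace_mul_orthogonal_le {D : Matrix n n ℝ} (hD : D.PosSemidef) (hQ : Qᵀ * Q = 1) :
    (D * Q).trace ≤ D.trace := by
  obtain ⟨B, rfl⟩ := exists_eq_transpose_mul_of_posSemidef hD
  linarith [norm_mul_one_sub_sq hQ B, sq_nonneg ‖B * (1 - Q)‖]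

theorem eq_one_of_trace_le_trace_mul_orthogonal {D : Matrix n n ℝ} (hD : D.PosDef)
    (hQ : Qᵀ * Q = 1) (h : D.trace ≤ (D * Q).trace) : Q = 1 := by
  obtain ⟨B, rfl⟩ := exists_eq_transpose_mul_of_posSemidef hD.posSemidef
  have hzero : B * (1 - Q) = 0 := by
    rw [← norm_eq_zero, ← sq_eq_zero_iff]
    exact le_antisymm (by linarith [norm_mul_one_sub_sq hQ B]) (sq_nonneg _)
  have hdet : IsUnit (Bᵀ * B) := hD.isUnit
  refine (sub_eq_zero.1 (hdet.mul_right_injective ?_)).symm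
  simp only [Matrix.mul_assoc, hzero, Matrix.mul_zero]

theorem norm_sub_one_sq_le_of_trace_le_trace_mul {A : Matrix n n ℝ} (hQ : Qᵀ * Q = 1)
    (h : A.trace ≤ (A * Q).trace) :
    ‖Q - 1‖ ^ 2 ≤ 4 * (√(Fintype.card n) * ‖A - 1‖) := by
  have hexpand := norm_mul_one_sub_sq hQ 1
  have hleft := abs_trace_le (A - 1)
  have hright := abs_trace_le ((A - 1) * Q)
  rw [norm_mul_orthogonal hQ, Matrix.sub_mul, Matrix.one_mul, trace_sub] at hright
  simp only [trace_sub, trace_one] at hleft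
  rw [Matrix.one_mul, transpose_one, Matrix.one_mul, Matrix.one_mul, trace_one] at hexpand
  rw [norm_sub_rev, hexpand]
  linarith [(abs_le.1 hleft).1, (abs_le.1 hright).2]

end Polar

theorem blochBlock_eq_mul_transpose (Λ : Superop 2) (W : unitaryGroup (Fin 2) ℂ) :
    blochBlock Λ =
      blochBlock (Λ * unitaryChannel W) * (blochBlock (unitaryChannel W))ᵀ := by
  rw [(isPosTP_unitaryChannel W).blochBlock_mul, Matrix.mul_assoc,
    mul_eq_one_comm.1 (blochBlock_unitaryChannel_orthogonal W), Matrix.mul_one]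

namespace IsOptimalCorrection

attribute [local instance] frobeniusNormedAddCommGroup frobeniusNormedSpace frobeniusInner

variable {Λ : Superop 2} {W W' : unitaryGroup (Fin 2) ℂ}

theorem transpose_eq (h : IsPosTP Λ) (hW : IsOptimalCorrection Λ W) :
    (blochBlock Λ * blochBlock (unitaryChannel W))ᵀ =
      blochBlock Λ * blochBlock (unitaryChannel W) := by
  refine transpose_eq_of_trace_mul_rotation_le fun V => ?_
  rw [Matrix.mul_assoc, ← blochBlock_unitaryChannel_mul]
  exact (isOptimalCorrection_iff h).1 hW (W * V)

theorem norm_sub_one_sq_le (h : IsPosTP Λ) (hW : IsOptimalCorrection Λ W) :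
    ‖blochBlock (unitaryChannel W) - 1‖ ^ 2 ≤ 8 * ‖blochBlock Λ - 1‖ := by
  have htrace := (isOptimalCorrection_iff h).1 hW 1
  rw [unitaryChannel_one, blochBlock_one, Matrix.mul_one] at htrace
  have hsqrt : √(Fintype.card (Fin 3) : ℝ) ≤ 2 := by
    rw [Real.sqrt_le_iff]
    norm_num
  calc ‖blochBlock (unitaryChannel W) - 1‖ ^ 2
      ≤ 4 * (√(Fintype.card (Fin 3) : ℝ) * ‖blochBlock Λ - 1‖) :=
        norm_sub_one_sq_le_of_trace_le_trace_mul (blochBlock_unitaryChannel_orthogonal W) htrace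
    _ ≤ 4 * (2 * ‖blochBlock Λ - 1‖) := by gcongr
    _ = 8 * ‖blochBlock Λ - 1‖ := by ring

theorem posDef (h : IsPosTP Λ) (hW : IsOptimalCorrection Λ W)
    (hΛ : ‖blochBlock Λ - 1‖ ≤ 1 / 1000) :
    (blochBlock Λ * blochBlock (unitaryChannel W)).PosDef := by
  refine posDef_of_norm_sub_one_lt (hW.transpose_eq h) ?_
  set O := blochBlock (unitaryChannel W)
  calc ‖blochBlock Λ * O - 1‖ = ‖(blochBlock Λ - 1) * O + (O - 1)‖ := by
        rw [Matrix.sub_mul, Matrix.one_mul, sub_add_sub_cancel]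
    _ ≤ ‖blochBlock Λ - 1‖ + ‖O - 1‖ := by
        rw [← norm_mul_orthogonal (blochBlock_unitaryChannel_orthogonal W) (blochBlock Λ - 1)]
        exact norm_add_le _ _
    _ < 1 := by nlinarith [hW.norm_sub_one_sq_le h]

theorem blochBlock_eq_transpose_of_polar (h : IsPosTP Λ) (hW : IsOptimalCorrection Λ W)
    (hΛ : ‖blochBlock Λ - 1‖ ≤ 1 / 1000) {D V : Matrix (Fin 3) (Fin 3) ℝ} (hD : D.PosSemidef)
    (hV : Vᵀ * V = 1) (hDV : blochBlock Λ = D * V) : blochBlock (unitaryChannel W) = Vᵀ := by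
  have hO := blochBlock_unitaryChannel_orthogonal W
  have hpos := hW.posDef h hΛ
  rw [hDV, Matrix.mul_assoc] at hpos
  set O := blochBlock (unitaryChannel W)
  have hVO : (V * O)ᵀ * (V * O) = 1 := by
    rw [transpose_mul, Matrix.mul_assoc, ← Matrix.mul_assoc Vᵀ, hV, Matrix.one_mul, hO]
  have hOV : V * O * (V * O)ᵀ = 1 := mul_eq_one_comm.1 hVO
  have hone : (V * O)ᵀ = 1 := by
    refine eq_one_of_trace_le_trace_mul_orthogonal hpos (by rwa [transpose_transpose]) ?_
    rw [Matrix.mul_assoc D, hOV, Matrix.mul_one]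
    exact trace_mul_orthogonal_le hD hVO
  calc O = Vᵀ * (V * O) := by rw [← Matrix.mul_assoc, hV, Matrix.one_mul]
    _ = Vᵀ := by rw [← transpose_transpose (V * O), hone, transpose_one, Matrix.mul_one]

theorem unique (h : IsPosTP Λ) (hW : IsOptimalCorrection Λ W) (hW' : IsOptimalCorrection Λ W')
    (hΛ : ‖blochBlock Λ - 1‖ ≤ 1 / 1000) : unitaryChannel W = unitaryChannel W' := by
  have hO := mul_eq_one_comm.1 (blochBlock_unitaryChannel_orthogonal W)
  have hpolar := hW'.blochBlock_eq_transpose_of_polar h hΛ (hW.posDef h hΛ).posSemidef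
    (by rwa [transpose_transpose])
    (by rw [Matrix.mul_assoc, hO, Matrix.mul_one])
  exact unitaryChannel_eq_of_blochBlock_eq (by rw [hpolar, transpose_transpose])

end IsOptimalCorrection

/-! ### Coherence -/

section Coherence

attribute [local instance] frobeniusNormedAddCommGroup frobeniusNormedSpace frobeniusInner

theorem IsContraction.abs_trace_div_card_sub_norm_div_sqrt_card_le {n : Type*} [Fintype n]
    [Nonempty n] {A : Matrix n n ℝ} (hA : IsContraction A) (hsym : Aᵀ = A)
    (htrace : 1 / 2 ≤ A.trace / Fintype.card n) :
    |A.trace / Fintype.card n - ‖A‖ / √(Fintype.card n)| ≤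
      (Fintype.card n - 1) * (1 - A.trace / Fintype.card n) ^ 2 := by
  classical
  have hcard : (0 : ℝ) < Fintype.card n := by exact_mod_cast Fintype.card_pos
  set d := (Fintype.card n : ℝ) with hd
  set t := A.trace / d with ht
  set s := ‖A‖ / √d with hs
  have htrace_eq : A.trace = d * t := by rw [ht]; field_simp
  have hnorm_eq : ‖A‖ ^ 2 = d * s ^ 2 := by
    rw [hs, div_pow, Real.sq_sqrt hcard.le]; field_simp
  have hle : t ≤ s := by
    rw [ht, hs, div_le_div_iff₀ hcard (Real.sqrt_pos.2 hcard)]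
    calc A.trace * √d ≤ √d * ‖A‖ * √d := by gcongr; exact (le_abs_self _).trans (abs_trace_le A)
      _ = ‖A‖ * d := by rw [mul_right_comm, Real.mul_self_sqrt hcard.le, mul_comm]
  have hdist : ‖1 - A‖ ^ 2 = d - 2 * (d * t) + d * s ^ 2 := by
    rw [@norm_sub_sq_real, norm_one_sq, inner_eq_trace, transpose_one, Matrix.one_mul, htrace_eq,
      hnorm_eq]
  have hsq : ‖1 - A‖ ^ 2 ≤ (d - d * t) ^ 2 := by
    have hproj := hA.norm_symmetric_part_one_sub_le
    rw [Submodule.starProjection_eq_self_iff.2 (mem_symmetricMatrices.2 (by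
      rw [transpose_sub, transpose_one, hsym])), trace_sub, trace_one, htrace_eq, ← hd] at hproj
    gcongr
  have hmul : (s - t) * (s + t) ≤ (d - 1) * (1 - t) ^ 2 := by
    refine le_of_mul_le_mul_left ?_ hcard
    linear_combination hsq.trans' hdist.ge
  rw [abs_sub_comm, abs_of_nonneg (sub_nonneg.2 hle)]
  exact (le_mul_of_one_le_right (sub_nonneg.2 hle) (by linarith)).trans hmul

theorem tracelessProj_pauli (k : Fin 4) :
    tracelessProj (pauli k) = if k = 0 then 0 else pauli k := by
  change pauli k - ((pauli k).trace / 2) • (1 : Matrix (Fin 2) (Fin 2) ℂ) = _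
  rw [trace_pauli]
  split_ifs with hk
  · rw [hk, pauli_zero]
    simp
  · simp

theorem liouville_tracelessProj :
    liouville tracelessProj = diagonal (fun k => if k = 0 then (0 : ℝ) else 1) := by
  ext j k
  rw [liouville, of_apply, tracelessProj_pauli, diagonal_apply]
  by_cases hk : k = 0
  · simp [hk]
  · rw [if_neg hk, trace_pauli_mul_pauli]
    by_cases hj : j = k <;> simp [hj, hk]

theorem hsInner_liouville_tracelessProj (Λ : Superop 2) :
    hsInner (liouville tracelessProj) (liouville Λ) = (blochBlock Λ).trace := by
  rw [hsInner, liouville_tracelessProj, diagonal_transpose, trace, Fin.sum_univ_succ]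
  simp [diagonal_mul, trace, blochBlock]

theorem frobNorm_liouville_tracelessProj : frobNorm (liouville tracelessProj) = √3 := by
  rw [frobNorm, hsInner, liouville_tracelessProj, diagonal_transpose, diagonal_mul_diagonal,
    trace_diagonal]
  congr 1
  simp [Fin.sum_univ_succ]

theorem frobNorm_liouville_mul_tracelessProj {Λ : Superop 2} (h : IsPosTP Λ) :
    frobNorm (liouville Λ * liouville tracelessProj) = ‖blochBlock Λ‖ := by
  have hentry (j k) : (liouville Λ * liouville tracelessProj) j k =
      if k = 0 then 0 else liouville Λ j k := by
    rw [liouville_tracelessProj, mul_diagonal]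
    split_ifs <;> simp
  rw [← Real.sqrt_sq (norm_nonneg (blochBlock Λ)), ← trace_transpose_mul_self, frobNorm, hsInner]
  congr 1
  simp only [trace, diag_apply, mul_apply (M := (_)ᵀ), transpose_apply, hentry]
  rw [Fin.sum_univ_succ]
  simp only [if_true, Fin.succ_ne_zero, if_false, mul_zero, Finset.sum_const_zero, zero_add]
  refine Finset.sum_congr rfl fun k _ => ?_
  rw [Fin.sum_univ_succ, h.liouville_zero, if_neg (Fin.succ_ne_zero k), mul_zero, zero_add]
  rfl

theorem coherenceDefect_eq {Λ : Superop 2} (h : IsPosTP Λ) :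
    coherenceDefect Λ = |(blochBlock Λ).trace / 3 - ‖blochBlock Λ‖ / √3| := by
  rw [coherenceDefect, hsInner_liouville_tracelessProj, frobNorm_liouville_tracelessProj,
    frobNorm_liouville_mul_tracelessProj h, Real.sq_sqrt (by norm_num)]

theorem coherenceDefect_le {Λ : Superop 2} (h : IsPosTP Λ)
    (hsym : (blochBlock Λ)ᵀ = blochBlock Λ) (htrace : 3 / 2 ≤ (blochBlock Λ).trace) :
    coherenceDefect Λ ≤ 8 * (1 - avgFidelity Λ 1) ^ 2 := by
  have hle := h.isContraction_blochBlock.abs_trace_div_card_sub_norm_div_sqrt_card_le hsym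
    (by norm_num; linarith)
  rw [coherenceDefect_eq h, avgFidelity_one h]
  norm_num at hle
  linear_combination hle

theorem IsOptimalCorrection.coherenceDefect_le {Λ : Superop 2} {W : unitaryGroup (Fin 2) ℂ}
    (h : IsPosTP Λ) (hW : IsOptimalCorrection Λ W) (hΛ : ‖blochBlock Λ - 1‖ ≤ 1 / 1000) :
    coherenceDefect (Λ * unitaryChannel W) ≤
      8 * (1 - avgFidelity (Λ * unitaryChannel W) 1) ^ 2 := by
  have hmul := (isPosTP_unitaryChannel W).blochBlock_mul (Λ := Λ)
  refine _root_.coherenceDefect_le (h.mul (isPosTP_unitaryChannel W)) ?_ ?_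
  · rw [hmul, hW.transpose_eq h]
  · have htrace := (isOptimalCorrection_iff h).1 hW 1
    rw [unitaryChannel_one, blochBlock_one, Matrix.mul_one] at htrace
    have habs := (abs_le.1 (abs_trace_le (blochBlock Λ - 1))).1
    have hsqrt : √(Fintype.card (Fin 3) : ℝ) ≤ 2 := by
      rw [Real.sqrt_le_iff]
      norm_num
    have hsmall : √(Fintype.card (Fin 3) : ℝ) * ‖blochBlock Λ - 1‖ ≤ 2 * (1 / 1000) := by
      gcongr
    rw [trace_sub, trace_one, Fintype.card_fin, Nat.cast_ofNat] at habs
    rw [Fintype.card_fin, Nat.cast_ofNat] at hsmall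
    rw [hmul]
    linarith

end Coherence

/-! ### Circuits -/

section Circuits

attribute [local instance] frobeniusNormedAddCommGroup frobeniusNormedSpace frobeniusInner
  frobeniusTopology completeSpace_matrix

variable {ι : Type*} {U : ι → unitaryGroup (Fin 2) ℂ} {N : ι → Superop 2}

theorem isPosTP_circuit (hN : ∀ i, IsPosTP (N i)) (m : ℕ) (s : Fin m → ι) :
    IsPosTP (circuit N m s) := by
  induction m with
  | zero => exact IsPosTP.one
  | succ m ih => exact (hN _).mul (ih _)

theorem circuit_unitaryChannel (U : ι → unitaryGroup (Fin 2) ℂ) (m : ℕ) (s : Fin m → ι) :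
    circuit (fun i => unitaryChannel (U i)) m s = unitaryChannel (circuit U m s) := by
  induction m with
  | zero => exact unitaryChannel_one.symm
  | succ m ih => rw [circuit, circuit, ih, unitaryChannel_mul]

/-- The Bloch blocks of the ideal gates. -/
abbrev idealBlocks (U : ι → unitaryGroup (Fin 2) ℂ) : ι → Matrix (Fin 3) (Fin 3) ℝ :=
  fun i => blochBlock (unitaryChannel (U i))

/-- The Bloch blocks of the noisy gates. -/
abbrev noisyBlocks (N : ι → Superop 2) : ι → Matrix (Fin 3) (Fin 3) ℝ :=
  fun i => blochBlock (N i)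

theorem idealBlocks_conj (U : ι → unitaryGroup (Fin 2) ℂ) (W : unitaryGroup (Fin 2) ℂ) :
    idealBlocks (fun i => W * U i * star W) = fun i =>
      blochBlock (unitaryChannel W) * idealBlocks U i * (blochBlock (unitaryChannel W))ᵀ := by
  funext i
  rw [idealBlocks, blochBlock_unitaryChannel_mul, blochBlock_unitaryChannel_mul,
    blochBlock_unitaryChannel_star]

variable [Fintype ι]

theorem expect_snoc {M : Type*} [AddCommGroup M] [Module ℚ≥0 M] (m : ℕ)
    (f : ι → (Fin m → ι) → M) :
    𝔼 s : Fin (m + 1) → ι, f (s (Fin.last m)) (Fin.init s) = 𝔼 s, 𝔼 i, f i s := by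
  rw [Finset.expect_comm, ← Finset.expect_product']
  exact Finset.expect_equiv (Fin.snocEquiv fun _ => ι).symm (by simp) fun s _ => rfl

theorem expect_circuit (U : ι → unitaryGroup (Fin 2) ℂ) (hN : ∀ i, IsPosTP (N i)) (m : ℕ)
    (X : Matrix (Fin 3) (Fin 3) ℝ) :
    𝔼 s : Fin m → ι, (blochBlock (unitaryChannel (circuit U m s)))ᵀ * X *
      blochBlock (circuit N m s) = (noisyTwirl (idealBlocks U) (noisyBlocks N) ^ m) X := by
  induction m generalizing X with
  | zero =>
    simp only [circuit, unitaryChannel_one, blochBlock_one, transpose_one, Matrix.one_mul,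
      Matrix.mul_one, pow_zero, one_apply_eq_self]
    exact Fintype.expect_const X
  | succ m ih =>
    rw [pow_succ, mul_apply_eq_comp, ← ih]
    simp only [circuit]
    rw [expect_snoc m fun i s => (blochBlock (unitaryChannel (U i * circuit U m s)))ᵀ * X *
      blochBlock (N i * circuit N m s)]
    refine Finset.expect_congr rfl fun s _ => ?_
    rw [noisyTwirl_apply, Finset.mul_expect, Finset.expect_mul]
    refine Finset.expect_congr rfl fun i _ => ?_
    rw [blochBlock_unitaryChannel_mul, (isPosTP_circuit hN m s).blochBlock_mul, transpose_mul]
    simp only [Matrix.mul_assoc]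

theorem isPosTP_rightError [Nonempty ι] (U : ι → unitaryGroup (Fin 2) ℂ)
    (hN : ∀ i, IsPosTP (N i)) (m : ℕ) : IsPosTP (rightError U N m) :=
  IsPosTP.expect fun s => (isPosTP_unitaryChannel _).mul (isPosTP_circuit hN m s)

theorem blochBlock_rightError (U : ι → unitaryGroup (Fin 2) ℂ) (hN : ∀ i, IsPosTP (N i))
    (m : ℕ) : blochBlock (rightError U N m) =
      (noisyTwirl (idealBlocks U) (noisyBlocks N) ^ m) 1 := by
  rw [rightError, blochBlock_expect, ← expect_circuit U hN]
  refine Finset.expect_congr rfl fun s _ => ?_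
  rw [(isPosTP_circuit hN m s).blochBlock_mul, blochBlock_unitaryChannel_star, Matrix.mul_one]

theorem isNoisyDesign_idealBlocks_noisyBlocks (hU : IsUnitaryTwoDesign U)
    (hN : ∀ i, IsPosTP (N i)) : IsNoisyDesign (idealBlocks U) (noisyBlocks N) where
  orthogonal i := blochBlock_unitaryChannel_orthogonal (U i)
  isContraction i := (hN i).isContraction_blochBlock
  twirl_eq X := by
    simpa using hU.expect_transpose_mul_mul X

variable [Nonempty ι]

theorem gateSetFidelity_eq (U : ι → unitaryGroup (Fin 2) ℂ) (hN : ∀ i, IsPosTP (N i)) (m : ℕ) :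
    gateSetFidelity N (fun i => unitaryChannel (U i)) m = 1 / 2 + 1 / 6 *
      ((noisyTwirl (idealBlocks U) (noisyBlocks N) ^ m) 1).trace := by
  have htrace := linearMap_expect (traceLinearMap (Fin 3) ℝ ℝ) fun s : Fin m → ι =>
    (blochBlock (unitaryChannel (circuit U m s)))ᵀ * 1 * blochBlock (circuit N m s)
  simp only [traceLinearMap_apply] at htrace
  rw [gateSetFidelity, ← expect_circuit U hN, htrace, Finset.mul_expect,
    ← Fintype.expect_const (ι := Fin m → ι) (1 / 2 : ℝ), ← Finset.expect_add_distrib]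
  refine Finset.expect_congr rfl fun s _ => ?_
  rw [circuit_unitaryChannel, avgFidelity_eq (isPosTP_circuit hN m s) (isPosTP_unitaryChannel _)
    (blochShift_unitaryChannel _), Matrix.mul_one]

theorem twirlDefect_idealBlocks_noisyBlocks (U : ι → unitaryGroup (Fin 2) ℂ)
    (hN : ∀ i, IsPosTP (N i)) : twirlDefect (idealBlocks U) (noisyBlocks N) =
      6 * (1 - gateSetFidelity N (fun i => unitaryChannel (U i)) 1) := by
  rw [gateSetFidelity_eq U hN, pow_one, trace_noisyTwirl_one, Fintype.card_fin]
  ring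

end Circuits

/-! ### The spectrum of the twirl -/

section Spectrum

attribute [local instance] frobeniusNormedAddCommGroup frobeniusNormedSpace frobeniusInner
  frobeniusTopology completeSpace_matrix

section RealMatrix

variable {n : Type*} [Fintype n]

theorem mem_spectrum_iff_exists_mulVec [DecidableEq n] (A : Matrix n n ℂ) (μ : ℂ) :
    μ ∈ spectrum ℂ A ↔ ∃ v : n → ℂ, v ≠ 0 ∧ A *ᵥ v = μ • v := by
  rw [← spectrum_toLin', ← Module.End.hasEigenvalue_iff_mem_spectrum]
  constructor
  · intro h
    obtain ⟨v, hv⟩ := h.exists_hasEigenvector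
    exact ⟨v, hv.2, by simpa using hv.apply_eq_smul⟩
  · rintro ⟨v, hv, h⟩
    exact Module.End.hasEigenvalue_of_hasEigenvector
      (Module.End.hasEigenvector_iff.2 ⟨Module.End.mem_eigenspace_iff.2 (by simpa using h), hv⟩)

theorem map_ofReal_mulVec_re (A : Matrix n n ℝ) (v : n → ℂ) (a : n) :
    ((A.map (fun x : ℝ => (x : ℂ)) *ᵥ v) a).re = (A *ᵥ fun b => (v b).re) a := by
  simp [mulVec, dotProduct]

theorem map_ofReal_mulVec_im (A : Matrix n n ℝ) (v : n → ℂ) (a : n) :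
    ((A.map (fun x : ℝ => (x : ℂ)) *ᵥ v) a).im = (A *ᵥ fun b => (v b).im) a := by
  simp [mulVec, dotProduct]

/-- A complex eigenvector is a pair of real vectors that the matrix rotates and scales. -/
theorem isHighestEigenvalue_of_real [DecidableEq n] {A : Matrix n n ℝ} {p : ℝ} (hp : 0 ≤ p)
    {x : n → ℝ} (hx0 : x ≠ 0) (hx : A *ᵥ x = p • x)
    (hle : ∀ (r s : ℝ) (u v : n → ℝ), A *ᵥ u = r • u - s • v → A *ᵥ v = s • u + r • v →
      u ≠ 0 ∨ v ≠ 0 → r ^ 2 + s ^ 2 ≤ p ^ 2) : IsHighestEigenvalue A p := by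
  refine ⟨(mem_spectrum_iff_exists_mulVec _ _).2
    ⟨fun a => (x a : ℂ), fun h0 => hx0 ?_, ?_⟩, fun μ hμ => ?_⟩
  · exact funext fun a => Complex.ofReal_eq_zero.1 (congrFun h0 a)
  · ext a
    refine Complex.ext ?_ ?_
    · rw [map_ofReal_mulVec_re]
      simpa using congrFun hx a
    · rw [map_ofReal_mulVec_im]
      simp [mulVec, dotProduct]
  · obtain ⟨w, hw0, hw⟩ := (mem_spectrum_iff_exists_mulVec _ _).1 hμ
    have hsq := hle μ.re μ.im (fun a => (w a).re) (fun a => (w a).im)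
      (funext fun a => by rw [← map_ofReal_mulVec_re, hw]; simp)
      (funext fun a => by rw [← map_ofReal_mulVec_im, hw]; simp; ring) (by
        contrapose! hw0
        exact funext fun a => Complex.ext (congrFun hw0.1 a) (congrFun hw0.2 a))
    refine le_of_sq_le_sq ?_ hp
    rw [← Complex.normSq_eq_norm_sq, Complex.normSq_apply]
    linarith

theorem eq_zero_of_mulVec_apply_eq_zero {A : Matrix n n ℝ} {r s : ℝ} {u v : n → ℝ}
    (hu : A *ᵥ u = r • u - s • v) (hv : A *ᵥ v = s • u + r • v) (hrs : r ^ 2 + s ^ 2 ≠ 0) {a : n}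
    (ha : ∀ x, (A *ᵥ x) a = 0) : u a = 0 ∧ v a = 0 := by
  have hua : r * u a - s * v a = 0 := by simpa [ha] using (congrFun hu a).symm
  have hva : s * u a + r * v a = 0 := by simpa [ha] using (congrFun hv a).symm
  constructor <;> refine (mul_eq_zero.1 ?_).resolve_left hrs
  · linear_combination r * hua + s * hva
  · linear_combination r * hva - s * hua

end RealMatrix

variable {ι : Type*} [Fintype ι] {U : ι → unitaryGroup (Fin 2) ℂ} {N : ι → Superop 2}

theorem liouville_unitaryChannel_mul_tracelessProj (u : unitaryGroup (Fin 2) ℂ) (j k : Fin 4) :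
    liouville (unitaryChannel u * tracelessProj) j k =
      if k = 0 then 0 else liouville (unitaryChannel u) j k := by
  rw [liouville, of_apply, Module.End.mul_apply, tracelessProj_pauli]
  split_ifs <;> simp [liouville]

theorem twirl_apply (a b : Fin 4 × Fin 4) : twirl U N a b =
    𝔼 i, (if b.1 = 0 then 0 else liouville (unitaryChannel (U i)) a.1 b.1) *
      liouville (N i) a.2 b.2 := by
  rw [twirl, expect_matrix_apply]
  refine Finset.expect_congr rfl fun i _ => ?_
  rw [← liouville_unitaryChannel_mul_tracelessProj]
  rfl

theorem twirl_zero_apply (j : Fin 4) (b : Fin 4 × Fin 4) : twirl U N (0, j) b = 0 := by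
  rw [twirl_apply]
  refine Finset.expect_eq_zero fun i _ => ?_
  rw [(isPosTP_unitaryChannel (U i)).liouville_zero]
  split_ifs <;> simp

theorem twirl_succ_zero_apply (hU : IsUnitaryTwoDesign U) (hN : ∀ i, IsPosTP (N i)) (j : Fin 3)
    (b : Fin 4 × Fin 4) : twirl U N (j.succ, 0) b = 0 := by
  obtain ⟨b, b'⟩ := b
  rw [twirl_apply]
  simp only [(hN _).liouville_zero]
  rw [← Finset.expect_mul]
  induction b using Fin.cases with
  | zero => simp
  | succ k =>
    have hmoment : 𝔼 i, liouville (unitaryChannel (U i)) j.succ k.succ = 0 := by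
      have := congrFun (congrFun hU.expect_blochBlock j) k
      rwa [expect_matrix_apply] at this
    simp only [Fin.succ_ne_zero, if_false, hmoment, zero_mul]

theorem twirl_mulVec_zero (x : Fin 4 × Fin 4 → ℝ) (j : Fin 4) : (twirl U N *ᵥ x) (0, j) = 0 := by
  simp [mulVec, dotProduct, twirl_zero_apply]

theorem twirl_mulVec_succ_zero (hU : IsUnitaryTwoDesign U) (hN : ∀ i, IsPosTP (N i))
    (x : Fin 4 × Fin 4 → ℝ) (j : Fin 3) : (twirl U N *ᵥ x) (j.succ, 0) = 0 := by
  simp [mulVec, dotProduct, twirl_succ_zero_apply hU hN]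

/-- The coefficients of a tensor in the Pauli basis that belong to pairs of traceless matrices. -/
def tracelessPart : (Fin 4 × Fin 4 → ℝ) →ₗ[ℝ] Matrix (Fin 3) (Fin 3) ℝ where
  toFun x := of fun j k => x (j.succ, k.succ)
  map_add' _ _ := rfl
  map_smul' _ _ := rfl

theorem tracelessPart_apply (x : Fin 4 × Fin 4 → ℝ) (j k : Fin 3) :
    tracelessPart x j k = x (j.succ, k.succ) := rfl

theorem eq_zero_of_tracelessPart_eq_zero {x : Fin 4 × Fin 4 → ℝ} (hx : tracelessPart x = 0)
    (hx0 : ∀ j, x (0, j) = 0) (hx1 : ∀ j : Fin 3, x (j.succ, 0) = 0) : x = 0 := by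
  ext ⟨a, b⟩
  refine Fin.cases (hx0 b) (fun j => ?_) a
  exact Fin.cases (hx1 j) (fun k => congrFun (congrFun hx j) k) b

theorem tracelessPart_twirl_mulVec {x : Fin 4 × Fin 4 → ℝ} (hx : ∀ k : Fin 3, x (k.succ, 0) = 0) :
    tracelessPart (twirl U N *ᵥ x) =
      (noisyTwirl (idealBlocks U) (noisyBlocks N)).adjoint (tracelessPart x) := by
  ext j j'
  rw [adjoint_noisyTwirl, noisyTwirl_apply, expect_matrix_apply, tracelessPart_apply, mulVec,
    dotProduct, Fintype.sum_prod_type, Fin.sum_univ_succ]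
  simp only [twirl_apply, if_true, zero_mul, Finset.expect_const_zero, Finset.sum_const_zero,
    zero_add, Fin.succ_ne_zero, if_false, Fin.sum_univ_succ (n := 3), hx, mul_zero,
    Finset.expect_mul, ← Finset.expect_sum_comm]
  refine Finset.expect_congr rfl fun i _ => ?_
  simp only [transpose_transpose, mul_apply, Finset.sum_mul]
  rw [Finset.sum_comm]
  refine Finset.sum_congr rfl fun k _ => Finset.sum_congr rfl fun k' _ => ?_
  simp only [tracelessPart_apply, transpose_apply, blochBlock, submatrix_apply]
  ring

theorem exists_twirl_mulVec_eq_smul (hU : IsUnitaryTwoDesign U) (hN : ∀ i, IsPosTP (N i)) {p : ℝ}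
    {X : Matrix (Fin 3) (Fin 3) ℝ} (hX0 : X ≠ 0)
    (hX : (noisyTwirl (idealBlocks U) (noisyBlocks N)).adjoint X = p • X) :
    ∃ x ≠ 0, twirl U N *ᵥ x = p • x := by
  let x : Fin 4 × Fin 4 → ℝ := fun a =>
    Fin.cases 0 (fun j => Fin.cases 0 (fun k => X j k) a.2) a.1
  have hx : tracelessPart x = X := rfl
  refine ⟨x, fun h0 => hX0 (by rw [← hx, h0, map_zero]), sub_eq_zero.1 ?_⟩
  refine eq_zero_of_tracelessPart_eq_zero ?_ (fun j => ?_) fun j => ?_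
  · rw [map_sub, map_smul, tracelessPart_twirl_mulVec fun _ => rfl, hx, hX, sub_self]
  · simp [twirl_mulVec_zero, x]
  · simp [twirl_mulVec_succ_zero hU hN, x]

theorem isHighestEigenvalue_twirl (hU : IsUnitaryTwoDesign U) (hN : ∀ i, IsPosTP (N i))
    {K : Submodule ℝ (Matrix (Fin 3) (Fin 3) ℝ)} [K.HasOrthogonalProjection]
    {E X Y : Matrix (Fin 3) (Fin 3) ℝ} {η p : ℝ}
    (hL : IsNearProjection K E (noisyTwirl (idealBlocks U) (noisyBlocks N)).adjoint η)
    (hXY : IsDominantPair K E (noisyTwirl (idealBlocks U) (noisyBlocks N)).adjoint η p X Y)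
    (hp : 7 * η ≤ p) : IsHighestEigenvalue (twirl U N) p := by
  have hX0 : X ≠ 0 := by
    rintro rfl
    simpa using hXY.inner_right
  have hp0 : 0 ≤ p := (mul_nonneg (by norm_num) hL.nonneg).trans hp
  obtain ⟨x, hx0, hx⟩ := exists_twirl_mulVec_eq_smul hU hN hX0 hXY.right
  refine isHighestEigenvalue_of_real hp0 hx0 hx fun r s u v hu hv huv => ?_
  by_cases hrs : r ^ 2 + s ^ 2 = 0
  · exact hrs.trans_le (sq_nonneg p)
  have hzero j := eq_zero_of_mulVec_apply_eq_zero hu hv hrs fun x => twirl_mulVec_zero x j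
  have hsucc j := eq_zero_of_mulVec_apply_eq_zero hu hv hrs fun x =>
    twirl_mulVec_succ_zero hU hN x j
  refine hXY.sq_add_sq_le_of_complex_eigenvector hL hp (u := tracelessPart u)
    (v := tracelessPart v) ?_ ?_ ?_
  · rw [← tracelessPart_twirl_mulVec fun j => (hsucc j).1, hu, map_sub, map_smul, map_smul]
  · rw [← tracelessPart_twirl_mulVec fun j => (hsucc j).2, hv, map_add, map_smul, map_smul]
  · refine huv.imp (mt fun h => ?_) (mt fun h => ?_)
    · exact eq_zero_of_tracelessPart_eq_zero h (fun j => (hzero j).1) fun j => (hsucc j).1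
    · exact eq_zero_of_tracelessPart_eq_zero h (fun j => (hzero j).2) fun j => (hsucc j).2

end Spectrum

/-! ### Decay of the circuit fidelity -/

section Decay

attribute [local instance] frobeniusNormedAddCommGroup frobeniusNormedSpace frobeniusInner
  frobeniusTopology completeSpace_matrix

variable {ι : Type*} [Fintype ι] {U : ι → unitaryGroup (Fin 2) ℂ} {N : ι → Superop 2}

theorem IsOptimalCorrection.noisyTwirl_pow_mem_symmetricMatrices [Nonempty ι]
    (hN : ∀ i, IsPosTP (N i)) {m : ℕ} {W : unitaryGroup (Fin 2) ℂ}
    (hW : IsOptimalCorrection (rightError U N m) W) :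
    (noisyTwirl (idealBlocks fun i => W * U i * star W) (noisyBlocks N) ^ m)
      (blochBlock (unitaryChannel W)) ∈ symmetricMatrices (Fin 3) := by
  have hO := blochBlock_unitaryChannel_orthogonal W
  have hsym := hW.transpose_eq (isPosTP_rightError U hN m)
  rw [idealBlocks_conj, noisyTwirl_conj_pow hO, hO, ← blochBlock_rightError U hN,
    mem_symmetricMatrices]
  set O := blochBlock (unitaryChannel W)
  set A := blochBlock (rightError U N m)
  have hconj : O * A = O * (A * O) * Oᵀ := by
    rw [Matrix.mul_assoc, Matrix.mul_assoc, mul_eq_one_comm.1 hO, Matrix.mul_one]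
  rw [hconj, transpose_mul, transpose_mul, hsym, transpose_transpose]
  simp only [Matrix.mul_assoc]

variable [Nonempty ι]

theorem norm_blochBlock_rightError_sub_one_le (hU : IsUnitaryTwoDesign U)
    (hN : ∀ i, IsPosTP (N i)) (hδ : 10 ^ 39 * twirlDefect (idealBlocks U) (noisyBlocks N) ≤ 1) :
    ‖blochBlock (rightError U N 4) - 1‖ ≤ 8 / 10 ^ 19 := by
  have hle := (isNoisyDesign_idealBlocks_noisyBlocks hU hN).norm_one_sub_noisyTwirl_pow_one_le 4
  rw [blochBlock_rightError U hN, norm_sub_rev]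
  have hcard : √(Fintype.card (Fin 3) : ℝ) ≤ 2 := Real.sqrt_le_iff.2 (by norm_num)
  have hsqrt : √(2 * twirlDefect (idealBlocks U) (noisyBlocks N)) ≤ 1 / 10 ^ 19 :=
    Real.sqrt_le_iff.2 ⟨by norm_num, by linarith⟩
  calc _ ≤ ((4 : ℕ) : ℝ) * (2 * (1 / 10 ^ 19)) := hle.trans (by gcongr)
    _ = 8 / 10 ^ 19 := by norm_num

/-- The correction is only controlled by the fourth root of the defect, hence the size of the
constant. -/
theorem IsOptimalCorrection.twirlDefect_conj_le (hU : IsUnitaryTwoDesign U)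
    (hN : ∀ i, IsPosTP (N i)) (hδ : 10 ^ 39 * twirlDefect (idealBlocks U) (noisyBlocks N) ≤ 1)
    {W : unitaryGroup (Fin 2) ℂ} (hW : IsOptimalCorrection (rightError U N 4) W) :
    twirlDefect (idealBlocks fun i => W * U i * star W) (noisyBlocks N) ≤ 3 / 10 ^ 8 := by
  have hO1 : ‖blochBlock (unitaryChannel W) - 1‖ ≤ 3 / 10 ^ 9 := by
    refine le_of_sq_le_sq ((hW.norm_sub_one_sq_le (isPosTP_rightError U hN 4)).trans ?_)
      (by norm_num)
    linarith [norm_blochBlock_rightError_sub_one_le hU hN hδ]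
  rw [idealBlocks_conj]
  refine ((isNoisyDesign_idealBlocks_noisyBlocks hU hN).twirlDefect_conj_le
    (blochBlock_unitaryChannel_orthogonal W)).trans ?_
  rw [Fintype.card_fin]
  norm_num at hδ hO1 ⊢
  linarith

theorem abs_gateSetFidelity_sub_le (hU : IsUnitaryTwoDesign U) (hN : ∀ i, IsPosTP (N i))
    (hδ : 10 ^ 39 * twirlDefect (idealBlocks U) (noisyBlocks N) ≤ 1)
    {p : ℝ} {X : Matrix (Fin 3) (Fin 3) ℝ}
    (hX : noisyTwirl (idealBlocks U) (noisyBlocks N) X = p • X) (hX0 : X ≠ 0) (hp : 1 / 2 ≤ p)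
    {W : unitaryGroup (Fin 2) ℂ} (hW : IsOptimalCorrection (rightError U N 4) W) (m : ℕ) :
    |gateSetFidelity N (fun i => unitaryChannel (W * U i * star W)) m -
      (1 / 2 + 1 / 2 * p ^ m)| ≤ 10 ^ 5 * (1 - p) ^ 2 := by
  have hA := norm_blochBlock_rightError_sub_one_le hU hN hδ
  have hO := blochBlock_unitaryChannel_orthogonal W
  have hO1 : ‖blochBlock (unitaryChannel W) - 1‖ ≤ 1 / 10 := by
    refine le_of_sq_le_sq ((hW.norm_sub_one_sq_le (isPosTP_rightError U hN 4)).trans ?_)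
      (by norm_num)
    linarith
  have hdefect := hW.twirlDefect_conj_le hU hN hδ
  have hsym := hW.noisyTwirl_pow_mem_symmetricMatrices hN
  rw [gateSetFidelity_eq (fun i => W * U i * star W) hN]
  rw [idealBlocks_conj] at hdefect hsym ⊢
  set O := blochBlock (unitaryChannel W)
  have hX' : noisyTwirl (fun i => O * idealBlocks U i * Oᵀ) (noisyBlocks N) (O * X) =
      p • (O * X) := by
    rw [noisyTwirl_conj, ← Matrix.mul_assoc, hO, Matrix.one_mul, hX, Matrix.mul_smul]
  have hX0' : O * X ≠ 0 := by rwa [← norm_ne_zero_iff, norm_orthogonal_mul hO, norm_ne_zero_iff]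
  have key := ((isNoisyDesign_idealBlocks_noisyBlocks hU hN).conj hO).abs_trace_pow_one_sub_pow_le
    (by rw [Fintype.card_fin]; norm_num at hdefect ⊢; linarith) hO hO1 hsym hX' hX0' hp m
  rw [Fintype.card_fin, Nat.cast_ofNat, abs_le] at key
  rw [abs_le]
  constructor <;> nlinarith [key.1, key.2, sq_nonneg (1 - p)]

theorem exists_isHighestEigenvalue_twirl (hU : IsUnitaryTwoDesign U) (hN : ∀ i, IsPosTP (N i))
    (hδ : 10 ^ 39 * twirlDefect (idealBlocks U) (noisyBlocks N) ≤ 1) :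
    ∃ p : ℝ, IsHighestEigenvalue (twirl U N) p ∧
      ∀ W, IsOptimalCorrection (rightError U N 4) W → ∀ m : ℕ,
        |gateSetFidelity N (fun i => unitaryChannel (W * U i * star W)) m
          - (1 / 2 + 1 / 2 * p ^ m)| ≤ 10 ^ 5 * (1 - p) ^ 2 := by
  have hL := (isNoisyDesign_idealBlocks_noisyBlocks hU hN).isNearProjection.adjoint
  have hη : √(2 * twirlDefect (idealBlocks U) (noisyBlocks N)) ≤ 1 / 2000 :=
    sqrt_two_mul_twirlDefect_le (by linarith)
  obtain ⟨p, X, Y, hXY⟩ := hL.exists_isDominantPair (hη.trans (by norm_num))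
  have hp : 1 / 2 ≤ p := by
    have hsq := pow_le_pow_left₀ (Real.sqrt_nonneg _) hη 2
    linarith [(abs_le.1 hXY.abs_sub_one_le).1]
  have hY := hXY.left
  rw [ContinuousLinearMap.adjoint_adjoint] at hY
  have hY0 : Y ≠ 0 := by
    rintro rfl
    simpa using hXY.inner_left
  exact ⟨p, isHighestEigenvalue_twirl hU hN hL hXY (by linarith),
    fun W hW m => abs_gateSetFidelity_sub_le hU hN hδ hY hY0 hp hW m⟩

end Decay

end

theorem proposition2_general :
    ∃ C : ℝ, 0 < C ∧ ∃ ε : ℝ, 0 < ε ∧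
      ∀ (ι : Type*) [Fintype ι] [Nonempty ι]
        (U : ι → unitaryGroup (Fin 2) ℂ) (N : ι → Superop 2),
        IsUnitaryTwoDesign U →
        (∀ i, IsPosTP (N i)) →
        1 - ε ≤ gateSetFidelity N (fun i => unitaryChannel (U i)) 1 →
        (∃ W, IsOptimalCorrection (rightError U N 4) W) ∧
        (∀ W W', IsOptimalCorrection (rightError U N 4) W →
          IsOptimalCorrection (rightError U N 4) W' → unitaryChannel W = unitaryChannel W') ∧
        (∃ p : ℝ, IsHighestEigenvalue (twirl U N) p ∧
          ∀ W, IsOptimalCorrection (rightError U N 4) W → ∀ m : ℕ,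
            |gateSetFidelity N (fun i => unitaryChannel (W * U i * star W)) m
              - (1 / 2 + 1 / 2 * p ^ m)| ≤ C * (1 - p) ^ 2) ∧
        (∀ W, IsOptimalCorrection (rightError U N 4) W →
          (blochBlock (rightError U N 4 * unitaryChannel W)).PosDef ∧
          blochBlock (rightError U N 4) =
            blochBlock (rightError U N 4 * unitaryChannel W) * (blochBlock (unitaryChannel W))ᵀ ∧
          coherenceDefect (rightError U N 4 * unitaryChannel W) ≤
            C * (1 - avgFidelity (rightError U N 4 * unitaryChannel W) 1) ^ 2) ∧
        (∀ D V : Matrix (Fin 3) (Fin 3) ℝ, D.PosSemidef → V ∈ orthogonalGroup (Fin 3) ℝ →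
          blochBlock (rightError U N 4) = D * V →
          ∃ W, blochBlock (unitaryChannel W) = Vᵀ ∧
            IsOptimalCorrection (rightError U N 4) W) := by
  refine ⟨10 ^ 5, by norm_num, 1 / 10 ^ 40, by norm_num, fun ι _ _ U N hU hN hF => ?_⟩
  have hδ : 10 ^ 39 * twirlDefect (idealBlocks U) (noisyBlocks N) ≤ 1 := by
    rw [twirlDefect_idealBlocks_noisyBlocks U hN]
    linarith
  have hE := isPosTP_rightError U hN 4
  have hE1 := (norm_blochBlock_rightError_sub_one_le hU hN hδ).trans
    (by norm_num : (8 / 10 ^ 19 : ℝ) ≤ 1 / 1000)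
  obtain ⟨W₀, hW₀⟩ := exists_isOptimalCorrection hE
  refine ⟨⟨W₀, hW₀⟩, fun W W' hW hW' => hW.unique hE hW' hE1,
    exists_isHighestEigenvalue_twirl hU hN hδ, fun W hW => ⟨?_, ?_, ?_⟩, fun D V hD hV hDV => ?_⟩
  · rw [(isPosTP_unitaryChannel W).blochBlock_mul]
    exact hW.posDef hE hE1
  · exact blochBlock_eq_mul_transpose _ W
  · exact (hW.coherenceDefect_le hE hE1).trans (by gcongr; norm_num)
  · exact ⟨W₀, hW₀.blochBlock_eq_transpose_of_polar hE hE1 hD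
      ((mem_orthogonalGroup_iff' _ _).1 hV) hDV, hW₀⟩

theorem proposition2 :
    ∃ C : ℝ, 0 < C ∧ ∃ ε : ℝ, 0 < ε ∧
      ∀ (ι : Type*) [Fintype ι] [Nonempty ι]
        (U : ι → unitaryGroup (Fin 2) ℂ) (N : ι → Superop 2),
        IsUnitaryTwoDesign U →
        (∀ i, IsChannel (N i)) →
        1 - ε ≤ gateSetFidelity N (fun i => unitaryChannel (U i)) 1 →
        -- the maximizer exists and is unique as a channel
        (∃ W, IsOptimalCorrection (rightError U N 4) W) ∧
        (∀ W W', IsOptimalCorrection (rightError U N 4) W →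
          IsOptimalCorrection (rightError U N 4) W' → unitaryChannel W = unitaryChannel W') ∧
        -- the main estimate holds for it, with `p` the highest eigenvalue of the twirl
        (∃ p : ℝ, IsHighestEigenvalue (twirl U N) p ∧
          ∀ W, IsOptimalCorrection (rightError U N 4) W → ∀ m : ℕ,
            |gateSetFidelity N (fun i => unitaryChannel (W * U i * star W)) m
              - (1 / 2 + 1 / 2 * p ^ m)| ≤ C * (1 - p) ^ 2) ∧
        -- it cancels the unitary part of the right error: what is left is positive and incoherent
        (∀ W, IsOptimalCorrection (rightError U N 4) W →
          (blochBlock (rightError U N 4 * unitaryChannel W)).PosDef ∧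
          blochBlock (rightError U N 4) =
            blochBlock (rightError U N 4 * unitaryChannel W) * (blochBlock (unitaryChannel W))ᵀ ∧
          coherenceDefect (rightError U N 4 * unitaryChannel W) ≤
            C * (1 - avgFidelity (rightError U N 4 * unitaryChannel W) 1) ^ 2) ∧
        -- it is read off from any polar decomposition of the Bloch block of the right error
        (∀ D V : Matrix (Fin 3) (Fin 3) ℝ, D.PosSemidef → V ∈ orthogonalGroup (Fin 3) ℝ →
          blochBlock (rightError U N 4) = D * V →
          ∃ W, blochBlock (unitaryChannel W) = Vᵀ ∧
            IsOptimalCorrection (rightError U N 4) W) := by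
  obtain ⟨C, hC, ε, hε, h⟩ := proposition2_general
  exact ⟨C, hC, ε, hε, fun ι _ _ U N hU hN => h ι U N hU fun i => (hN i).isPosTP⟩
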